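/- Let $K$ be an arbitrary field and let $\Lambda=\Lambda(x_i\mid i\ge 0)$ be the Grassmann algebra over $K$ in the letters $x_0,x_1,\dots$, with its $\mathbb Z_2$-grading by parity. Let $\partial_i$ be the odd superderivation of $\Lambda$ with $\partial_i(x_j)=\delta_{ij}$, identify $x_i$ with left multiplication by $x_i$, and define the odd superderivations (acting on each element of $\Lambda$ through finitely many terms) $$v_i=\partial_i+x_ix_{i+1}\bigl(\partial_{i+3}+x_{i+3}x_{i+4}(\partial_{i+6}+x_{i+6}x_{i+7}(\partial_{i+9}+\cdots))\bigr),\qquad i\ge 0 .$$ Let $\mathbf Q=\mathrm{Lie}(v_0,v_1,v_2)\subset \mathrm{End}\,\Lambda$ be the Lie superalgebra generated by $v_0,v_1,v_2$ under the supercommutator $[a,b]=ab-(-1)^{|a||b|}ba$ and, if $\operatorname{char}K=2$, also under squaring $a\mapsto a^2$ of odd elements. For a finite set $X$ of homogeneous generators of $\mathbf Q$, let $\gamma(X,n)$ be the dimension of the span of all Lie monomials in $X$ of length at most $n$ together with, if $\operatorname{char}K=2$, the squares of the odd Lie monomials of length at most $n/2$. Put $$\operatorname{GKdim}\mathbf Q=\limsup_{n\to\infty}\frac{\ln\gamma(X,n)}{\ln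 n},\qquad \underline{\operatorname{GKdim}}\,\mathbf Q=\liminf_{n\to\infty}\frac{\ln\gamma(X,n)}{\ln n}.$$ Theorem. The polynomial $t^3-t-2$ has exactly one real root $\lambda$, and $\lambda\approx 1.5214$ (within $10^{-4}$). For $X=\{v_0,v_1,v_2\}$, and likewise for every finite set $X$ of homogeneous generators of $\mathbf Q$, $$\operatorname{GKdim}\mathbf Q=\underline{\operatorname{GKdim}}\,\mathbf Q=\log_\lambda 2\approx 1.6518\quad(\text{within }10^{-4}).$$ -/

import Mathlib

noncomputable section

namespace FractalSuper

/-! ### Lie superalgebras inside an associative superalgebra, and their growth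

Throughout, `A` is an associative algebra and `𝒜 0`, `𝒜 1` are its even and odd parts. -/

section General

variable {K A : Type*} [Field K] [Ring A] [Algebra K A] (𝒜 : ZMod 2 → Submodule K A)

/-- The supercommutator `[a, b] = a b - (-1)^{|a||b|} b a` of homogeneous elements `a`, `b`
of parities `α`, `β`. -/
def superComm (α β : ZMod 2) (a b : A) : A :=
  a * b - (-1) ^ (α.val * β.val) * (b * a)

/-- `L` is a Lie subsuperalgebra of `A^{(-)}`: a `ℤ/2`-graded subspace, closed under the
supercommutator and under squares of odd elements. If the characteristic is not `2`, then the last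
condition follows from the previous one, since `[a, a] = 2 a²` for odd `a`; in characteristic `2`
it is closure under the quadratic map. -/
structure IsLieSubsuperalgebra (L : Submodule K A) : Prop where
  graded : ∀ a ∈ L, ∃ a₀ ∈ L ⊓ 𝒜 0, ∃ a₁ ∈ L ⊓ 𝒜 1, a = a₀ + a₁
  superComm_mem : ∀ (α β : ZMod 2) (a b : A), a ∈ L ⊓ 𝒜 α → b ∈ L ⊓ 𝒜 β →
    superComm α β a b ∈ L
  sq_mem : ∀ a ∈ L ⊓ 𝒜 1, a * a ∈ L

/-- `Lie(X)`: the Lie subsuperalgebra generated by `X`. -/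
def lieSuper (X : Set A) : Submodule K A :=
  sInf {L | X ⊆ L ∧ IsLieSubsuperalgebra 𝒜 L}

/-- `IsLieMonomial 𝒜 X n α m`: `m` is a Lie monomial (with any arrangement of brackets) of
length `n` and of parity `α` in the homogeneous elements of `X`. -/
inductive IsLieMonomial (X : Set A) : ℕ → ZMod 2 → A → Prop
  | gen {α : ZMod 2} {x : A} : x ∈ X → x ∈ 𝒜 α → IsLieMonomial X 1 α x
  | bracket {m n : ℕ} {α β : ZMod 2} {a b : A} : IsLieMonomial X m α a → IsLieMonomial X n β b →
      IsLieMonomial X (m + n) (α + β) (superComm α β a b)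

/-- The space `L^{(X,n)}` spanned by the Lie monomials in `X` of length at most `n` and by the
squares of the odd Lie monomials of length at most `n / 2`. (Unless the characteristic is `2`, the
squares do not enlarge it: `m² = [m, m] / 2`.) -/
def growthSpace (X : Set A) (n : ℕ) : Submodule K A :=
  Submodule.span K
    ({m | ∃ k ≤ n, ∃ α, IsLieMonomial 𝒜 X k α m} ∪
      {s | ∃ k, 2 * k ≤ n ∧ ∃ m, IsLieMonomial 𝒜 X k 1 m ∧ s = m * m})

/-- The growth function `γ(X, n) = dim L^{(X,n)}`; the dimension is finite for finite `X`. -/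
def growth (X : Set A) (n : ℕ) : ℕ :=
  Module.finrank K (growthSpace 𝒜 X n)

/-- The (upper) Gelfand-Kirillov dimension `limsup ln γ(n) / ln n` of the Lie superalgebra
generated by `X`, computed with the generating set `X`. -/
def gkDim (X : Set A) : EReal :=
  Filter.limsup (fun n : ℕ => ((Real.log (growth 𝒜 X n) / Real.log n : ℝ) : EReal)) Filter.atTop

/-- The lower Gelfand-Kirillov dimension `liminf ln γ(n) / ln n`. -/
def lowerGkDim (X : Set A) : EReal :=
  Filter.liminf (fun n : ℕ => ((Real.log (growth 𝒜 X n) / Real.log n : ℝ) : EReal)) Filter.atTop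

end General

/-! ### The Grassmann algebra in the letters `x₀, x₁, …` and the pivot elements -/

section Pivot

variable (K : Type*) [Field K]

/-- The Grassmann algebra `Λ(x_i | i ≥ 0)`. -/
abbrev Grassmann : Type _ := ExteriorAlgebra K (ℕ →₀ K)

/-- The grading `End_α Λ = {φ | φ(Λ_β) ⊆ Λ_{α+β} for all β}` of the space of endomorphisms
of `Λ = Λ₀ ⊕ Λ₁`. -/
def endGrading (α : ZMod 2) : Submodule K (Module.End K (Grassmann K)) where
  carrier := {φ | ∀ β : ZMod 2, ∀ f ∈ CliffordAlgebra.evenOdd (0 : QuadraticForm K (ℕ →₀ K)) β,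
    φ f ∈ CliffordAlgebra.evenOdd (0 : QuadraticForm K (ℕ →₀ K)) (α + β)}
  add_mem' h₁ h₂ β f hf := Submodule.add_mem _ (h₁ β f hf) (h₂ β f hf)
  zero_mem' _ _ _ := Submodule.zero_mem _
  smul_mem' c _ h β f hf := Submodule.smul_mem _ c (h β f hf)

/-- The letter `x_i`, as an element of `Λ`. -/
def letter (i : ℕ) : Grassmann K := ExteriorAlgebra.ι K (Finsupp.single i 1)

/-- The superderivative `∂_i` of `Λ`, with `∂_i(x_j) = δ_{ij}`: the left contraction with the
`i`-th coordinate functional. -/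
def partialD (i : ℕ) : Module.End K (Grassmann K) :=
  CliffordAlgebra.contractLeft (Q := (0 : QuadraticForm K (ℕ →₀ K))) (Finsupp.lapply i)

theorem partialD_letter_mul (i : ℕ) (v : ℕ →₀ K) (f : Grassmann K) :
    partialD K i (ExteriorAlgebra.ι K v * f)
      = v i • f - ExteriorAlgebra.ι K v * partialD K i f :=
  CliffordAlgebra.contractLeft_ι_mul _ _ _

/-- Every element of `Λ` involves only finitely many letters. -/
theorem partialD_eventually_zero (f : Grassmann K) :
    ∃ N, ∀ k, N ≤ k → partialD K k f = 0 := by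
  induction f using CliffordAlgebra.left_induction with
  | algebraMap r => exact ⟨0, fun k _ => CliffordAlgebra.contractLeft_algebraMap _ _ r⟩
  | add x y hx hy =>
    obtain ⟨N, hN⟩ := hx
    obtain ⟨M, hM⟩ := hy
    refine ⟨max N M, fun k hk => ?_⟩
    rw [map_add, hN k (le_of_max_le_left hk), hM k (le_of_max_le_right hk), add_zero]
  | ι_mul x v hx =>
    obtain ⟨N, hN⟩ := hx
    refine ⟨max N (v.support.sup id + 1), fun k hk => ?_⟩
    have h1 : v k = 0 := by
      by_contra hne
      have : k ≤ v.support.sup id :=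
        Finset.le_sup (f := id) (Finsupp.mem_support_iff.mpr hne)
      have := le_of_max_le_right hk
      omega
    have h2 := partialD_letter_mul K k v x
    rw [h1, hN k (le_of_max_le_left hk), zero_smul, mul_zero, sub_zero] at h2
    exact h2

/-- The coefficient `x_i x_{i+1} · x_{i+3} x_{i+4} ⋯ x_{i+3l-3} x_{i+3l-2}` of `∂_{i+3l}` in the
pivot element `v_i`. -/
def pivotCoeff (i : ℕ) : ℕ → Grassmann K
  | 0 => 1
  | l + 1 => pivotCoeff i l * (letter K (i + 3 * l) * letter K (i + 3 * l + 1))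

theorem pivot_support_finite (i : ℕ) (f : Grassmann K) :
    (Function.support fun l => pivotCoeff K i l * partialD K (i + 3 * l) f).Finite := by
  obtain ⟨N, hN⟩ := partialD_eventually_zero K f
  refine (Set.finite_lt_nat N).subset fun l hl => ?_
  by_contra hlt
  refine hl ?_
  have hle : N ≤ i + 3 * l := by
    have : ¬ l < N := hlt
    omega
  change pivotCoeff K i l * partialD K (i + 3 * l) f = 0
  rw [hN _ hle, mul_zero]

/-- The pivot element `v_i = ∂_i + x_i x_{i+1} (∂_{i+3} + x_{i+3} x_{i+4} (∂_{i+6} + ⋯))`, as an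
endomorphism of `Λ`; only finitely many terms act nontrivially on a given element of `Λ`. -/
def pivot (i : ℕ) : Module.End K (Grassmann K) where
  toFun f := ∑ᶠ l : ℕ, pivotCoeff K i l * partialD K (i + 3 * l) f
  map_add' f g := by
    rw [← finsum_add_distrib (pivot_support_finite K i f) (pivot_support_finite K i g)]
    exact finsum_congr fun l => by rw [map_add, mul_add]
  map_smul' c f := by
    rw [RingHom.id_apply, smul_finsum' c (pivot_support_finite K i f)]
    exact finsum_congr fun l => by rw [map_smul, mul_smul_comm]

theorem pivotCoeff_succ (i l : ℕ) :
    pivotCoeff K i (l + 1) = letter K i * letter K (i + 1) * pivotCoeff K (i + 3) l := by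
  induction l with
  | zero => simp [pivotCoeff]
  | succ l ih =>
    rw [pivotCoeff, ih, pivotCoeff, show i + 3 * (l + 1) = i + 3 + 3 * l by ring, mul_assoc]

/-- The recursion `v_i = ∂_i + x_i x_{i+1} v_{i+3}`. -/
theorem pivot_rec (i : ℕ) (f : Grassmann K) :
    pivot K i f = partialD K i f + letter K i * letter K (i + 1) * pivot K (i + 3) f := by
  change (∑ᶠ l : ℕ, pivotCoeff K i l * partialD K (i + 3 * l) f) = _ + _ *
    ∑ᶠ l : ℕ, pivotCoeff K (i + 3) l * partialD K (i + 3 + 3 * l) f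
  obtain ⟨N, hN⟩ := partialD_eventually_zero K f
  have key : ∀ j, (∀ M, N ≤ M → (∑ᶠ l : ℕ, pivotCoeff K j l * partialD K (j + 3 * l) f)
      = ∑ l ∈ Finset.range M, pivotCoeff K j l * partialD K (j + 3 * l) f) := by
    intro j M hM
    refine finsum_eq_sum_of_support_subset _ fun l hl => ?_
    rw [Finset.coe_range, Set.mem_Iio]
    by_contra hlt
    refine hl ?_
    change pivotCoeff K j l * partialD K (j + 3 * l) f = 0
    rw [hN _ (by omega), mul_zero]
  rw [key i (N + 1) (by omega), key (i + 3) N le_rfl, Finset.sum_range_succ', Finset.mul_sum,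
    add_comm]
  congr 1
  · simp [pivotCoeff]
  · refine Finset.sum_congr rfl fun l _ => ?_
    rw [pivotCoeff_succ, mul_assoc, show i + 3 * (l + 1) = i + 3 + 3 * l by ring]

/-- The generators `v₀, v₁, v₂`. -/
def pivotGens : Set (Module.End K (Grassmann K)) := {pivot K 0, pivot K 1, pivot K 2}

/-- The Lie superalgebra `Q = Lie(v₀, v₁, v₂)` of superderivations of `Λ`. -/
def Q : Submodule K (Module.End K (Grassmann K)) := lieSuper (endGrading K) (pivotGens K)

theorem letter_mul_mem {β : ZMod 2} (v : ℕ →₀ K) {f : Grassmann K}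
    (hf : f ∈ CliffordAlgebra.evenOdd (0 : QuadraticForm K (ℕ →₀ K)) β) :
    ExteriorAlgebra.ι K v * f ∈ CliffordAlgebra.evenOdd (0 : QuadraticForm K (ℕ →₀ K)) (1 + β) :=
  SetLike.mul_mem_graded (CliffordAlgebra.ι_mem_evenOdd_one _ _) hf

theorem partialD_odd (i : ℕ) : partialD K i ∈ endGrading K 1 := by
  intro β f hf
  have hc : ∀ γ : ZMod 2, 1 + (1 + γ) = γ := by decide
  induction f, hf using CliffordAlgebra.evenOdd_induction with
  | range_ι_pow v h =>
    have h01 : ∀ γ : ZMod 2, γ = 0 ∨ γ = 1 := by decide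
    rcases h01 β with rfl | rfl
    · rw [show (0 : ZMod 2).val = 0 from rfl, pow_zero] at h
      obtain ⟨r, rfl⟩ := Submodule.mem_one.mp h
      have : partialD K i (algebraMap K _ r) = 0 := CliffordAlgebra.contractLeft_algebraMap _ _ r
      exact this ▸ Submodule.zero_mem _
    · rw [show (1 : ZMod 2).val = 1 from rfl, pow_one] at h
      obtain ⟨m, rfl⟩ := h
      have : partialD K i (ExteriorAlgebra.ι K m) = algebraMap K _ (m i) :=
        CliffordAlgebra.contractLeft_ι _ _ m
      exact this ▸ SetLike.algebraMap_mem_graded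
        (CliffordAlgebra.evenOdd (0 : QuadraticForm K (ℕ →₀ K))) (m i)
  | add x y hx hy ihx ihy => rw [map_add]; exact Submodule.add_mem _ ihx ihy
  | ι_mul_ι_mul m₁ m₂ x hx ih =>
    have h1 : partialD K i (ExteriorAlgebra.ι K m₁ * (ExteriorAlgebra.ι K m₂ * x))
        = m₁ i • (ExteriorAlgebra.ι K m₂ * x) - ExteriorAlgebra.ι K m₁ *
          (m₂ i • x - ExteriorAlgebra.ι K m₂ * partialD K i x) := by
      rw [partialD_letter_mul, partialD_letter_mul]
    have h2 : partialD K i (ExteriorAlgebra.ι K m₁ * (ExteriorAlgebra.ι K m₂ * x)) ∈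
        CliffordAlgebra.evenOdd (0 : QuadraticForm K (ℕ →₀ K)) (1 + β) := by
      rw [h1]
      refine Submodule.sub_mem _ (Submodule.smul_mem _ _ (letter_mul_mem K m₂ hx))
        (letter_mul_mem K m₁ (Submodule.sub_mem _ (Submodule.smul_mem _ _ hx) ?_))
      have h3 := letter_mul_mem K m₂ ih
      rwa [hc] at h3
    rw [← mul_assoc] at h2
    exact h2

theorem pivotCoeff_even (i l : ℕ) :
    pivotCoeff K i l ∈ CliffordAlgebra.evenOdd (0 : QuadraticForm K (ℕ →₀ K)) 0 := by
  induction l with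
  | zero => exact SetLike.one_mem_graded (CliffordAlgebra.evenOdd (0 : QuadraticForm K (ℕ →₀ K)))
  | succ l ih =>
    have h := SetLike.mul_mem_graded ih
      (CliffordAlgebra.ι_mul_ι_mem_evenOdd_zero (0 : QuadraticForm K (ℕ →₀ K))
        (Finsupp.single (i + 3 * l) 1) (Finsupp.single (i + 3 * l + 1) 1))
    rw [add_zero] at h
    exact h

/-- The pivot elements are odd. -/
theorem pivot_odd (i : ℕ) : pivot K i ∈ endGrading K 1 := by
  intro β f hf
  refine finsum_induction
    (fun g => g ∈ CliffordAlgebra.evenOdd (0 : QuadraticForm K (ℕ →₀ K)) (1 + β))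
    (Submodule.zero_mem _) (fun _ _ h₁ h₂ => Submodule.add_mem _ h₁ h₂) fun l => ?_
  have h := SetLike.mul_mem_graded (pivotCoeff_even K i l) (partialD_odd K (i + 3 * l) β f hf)
  rw [zero_add] at h
  exact h

end Pivot

end FractalSuper

end

noncomputable section

namespace FractalSuper

/-! ### Monomials of the Grassmann algebra -/

section Monomials

variable {K : Type*} [Field K]

/-! Give `v_n` the weight `λ^n` and `x_j` the weight `-λ^j`. Since `λ^3 = λ + 2`, the terms `∂_n`
and `x_n x_{n+1} v_{n+3}` of `v_n` have the same weight. Hence weights add under the supercommutator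
and double under squaring, in every characteristic.

Upper bound. The anticommutator of two pivot elements is a single monomial times a pivot element
(`exists_pivotComm_eq`), so the bracket of `f v_n` and `g v_m` with `n ≤ m` is `f v_n(g) v_m` plus a
multiple of one further term `h v_N`. This keeps `Q` inside the span of the `x_S v_n` with `S`
admissible (`superComm_pivotTerm_mem`, `pivotMonomials_sq_mem`). Admissibility keeps the letters
from cancelling the weight of `v_n`: at least `λ^n / 50` remains (`Admissible.le_weight`). If the
generators have weight at most `t`, length `n` allows only weight at most `n t`, hence only heads
`v_m` with `λ^m ≤ 50 n t`. These span at most `2^M` dimensions once `λ^M > 50 n t`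
(`pivotSpan_finrank`), which is of order `n^{log_λ 2}`.

Lower bound. Brackets produce `v_n` within length `N λ^n` (`pivot_mem_lieSpan`), where `N` bounds
the lengths needed for `v_0, v_1, v_2`. Further brackets build the long monomial `x_2 ⋯ x_{n-3} v_n`
for `n = 3k + 4`, and bracketing with `v_j` deletes `x_j` at cost `N λ^j`. So all `2^{3k}`
submonomials appear within length `2 N λ^{3k+4}` (`map_letterSpan_le_growthSpace`), again of order
`n^{log_λ 2}`.

A change of generating set affects only the constants `t` and `N`, so both limits equal `log_λ 2`.
-/

theorem letter_mul_self (i : ℕ) : letter K i * letter K i = 0 :=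
  ExteriorAlgebra.ι_sq_zero _

theorem letter_mul_swap (i j : ℕ) : letter K i * letter K j = -(letter K j * letter K i) :=
  eq_neg_of_add_eq_zero_left (ExteriorAlgebra.ι_add_mul_swap _ _)

theorem letter_mul_self_mul (i : ℕ) (f : Grassmann K) : letter K i * (letter K i * f) = 0 := by
  rw [← mul_assoc, letter_mul_self, zero_mul]

theorem letter_mul_left_comm (i j : ℕ) (f : Grassmann K) :
    letter K i * (letter K j * f) = -(letter K j * (letter K i * f)) := by
  rw [← mul_assoc, letter_mul_swap, neg_mul, mul_assoc]

/-- `IsMon S f`: `f` is a scalar multiple of the product (in some order) of the letters `x_i`,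
`i ∈ S`. -/
inductive IsMon : Finset ℕ → Grassmann K → Prop
  | scalar (c : K) : IsMon ∅ (algebraMap K _ c)
  | letter_mul {S : Finset ℕ} {f : Grassmann K} (i : ℕ) (hi : i ∉ S) (hf : IsMon S f) :
      IsMon (insert i S) (letter K i * f)

namespace IsMon

variable {S T : Finset ℕ} {f g : Grassmann K}

theorem smul (hf : IsMon S f) (c : K) : IsMon S (c • f) := by
  induction hf with
  | scalar d => rw [Algebra.smul_def, ← map_mul]; exact .scalar _
  | letter_mul i hi _ ih => rw [← mul_smul_comm]; exact .letter_mul i hi ih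

theorem neg (hf : IsMon S f) : IsMon S (-f) := by
  simpa using hf.smul (-1)

theorem letter_comm (hf : IsMon S f) (i : ℕ) :
    f * letter K i = (-1 : K) ^ S.card • (letter K i * f) := by
  induction hf with
  | scalar c => simpa using Algebra.commutes c (letter K i)
  | letter_mul j hj _ ih =>
    rw [mul_assoc, ih, mul_smul_comm, letter_mul_left_comm, Finset.card_insert_of_notMem hj,
      pow_succ, mul_smul, neg_one_smul]

theorem letter_mul_eq_zero (hf : IsMon S f) {i : ℕ} (hi : i ∈ S) : letter K i * f = 0 := by
  induction hf with
  | scalar c => simp at hi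
  | letter_mul j hj hf ih =>
    rcases Finset.mem_insert.mp hi with rfl | h
    · exact letter_mul_self_mul _ _
    · rw [letter_mul_left_comm, ih h, mul_zero, neg_zero]

theorem exists_letter_mul (hf : IsMon S f) {i : ℕ} (hi : i ∈ S) :
    ∃ g, IsMon (S.erase i) g ∧ f = letter K i * g := by
  induction hf with
  | scalar c => simp at hi
  | @letter_mul S f j hj hf ih =>
    rcases eq_or_ne i j with rfl | hij
    · exact ⟨f, by rwa [Finset.erase_insert hj], rfl⟩
    · obtain ⟨g, hg, rfl⟩ := ih (Finset.mem_of_mem_insert_of_ne hi hij)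
      refine ⟨-(letter K j * g), ?_, by rw [letter_mul_left_comm, mul_neg]⟩
      rw [Finset.erase_insert_of_ne hij.symm]
      exact (IsMon.letter_mul j (fun h => hj (Finset.mem_of_mem_erase h)) hg).neg

/-- Disjointness is recorded with the product because weights and parities are additive only over
disjoint supports. -/
theorem mul_cases (hf : IsMon S f) (hg : IsMon T g) :
    (Disjoint S T ∧ IsMon (S ∪ T) (f * g)) ∨ f * g = 0 := by
  induction hf with
  | scalar c =>
    refine Or.inl ⟨Finset.disjoint_empty_left _, ?_⟩
    rw [← Algebra.smul_def, Finset.empty_union]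
    exact hg.smul c
  | letter_mul i hi _ ih =>
    rw [mul_assoc]
    rcases ih with ⟨hd, h⟩ | h
    · by_cases hT : i ∈ T
      · exact Or.inr (h.letter_mul_eq_zero (Finset.mem_union_right _ hT))
      · refine Or.inl ⟨Finset.disjoint_insert_left.mpr ⟨hT, hd⟩, ?_⟩
        rw [Finset.insert_union]
        exact .letter_mul i (by simp [hi, hT]) h
    · exact Or.inr (by rw [h, mul_zero])

theorem mul_comm (hf : IsMon S f) (hg : IsMon T g) :
    g * f = (-1 : K) ^ (S.card * T.card) • (f * g) := by
  induction hf with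
  | scalar c => simpa using (Algebra.commutes c g).symm
  | letter_mul i hi _ ih =>
    rw [← mul_assoc, hg.letter_comm, smul_mul_assoc, mul_assoc, ih, mul_smul_comm, smul_smul,
      Finset.card_insert_of_notMem hi, ← pow_add, mul_assoc]
    ring_nf

theorem mul_self_eq_zero (hf : IsMon S f) (hS : S.Nonempty) : f * f = 0 := by
  rcases hf.mul_cases hf with ⟨h, -⟩ | h
  · exact absurd (Finset.disjoint_self_iff_empty S |>.mp h) hS.ne_empty
  · exact h

theorem mem_evenOdd (hf : IsMon S f) :
    f ∈ CliffordAlgebra.evenOdd (0 : QuadraticForm K (ℕ →₀ K)) (S.card : ZMod 2) := by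
  induction hf with
  | scalar c =>
    simpa using SetLike.algebraMap_mem_graded
      (CliffordAlgebra.evenOdd (0 : QuadraticForm K (ℕ →₀ K))) c
  | letter_mul i hi _ ih =>
    rw [Finset.card_insert_of_notMem hi, Nat.cast_succ, add_comm]
    exact letter_mul_mem K _ ih

end IsMon

theorem isMon_letter (i : ℕ) : IsMon {i} (letter K i) := by
  simpa using IsMon.letter_mul i (Finset.notMem_empty i) (IsMon.scalar (1 : K))

theorem isMon_one : IsMon ∅ (1 : Grassmann K) := by
  simpa using IsMon.scalar (1 : K)

theorem isMon_pair (i : ℕ) : IsMon {i, i + 1} (letter K i * letter K (i + 1)) :=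
  .letter_mul i (by simp) (isMon_letter (i + 1))

end Monomials

/-! ### The superderivations `∂_n` and `v_n` -/

section Derivations

variable {K : Type*} [Field K] {S T : Finset ℕ} {f g : Grassmann K}

theorem partialD_letter_mul_self (i : ℕ) (f : Grassmann K) :
    partialD K i (letter K i * f) = f - letter K i * partialD K i f := by
  rw [letter, partialD_letter_mul, Finsupp.single_eq_same, one_smul]

theorem partialD_letter_mul_of_ne {i j : ℕ} (h : i ≠ j) (f : Grassmann K) :
    partialD K i (letter K j * f) = -(letter K j * partialD K i f) := by
  rw [letter, partialD_letter_mul, Finsupp.single_eq_of_ne h, zero_smul, zero_sub]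

theorem partialD_algebraMap (i : ℕ) (c : K) :
    partialD K i (algebraMap K _ c) = 0 :=
  CliffordAlgebra.contractLeft_algebraMap _ _ c

theorem partialD_partialD (i : ℕ) (f : Grassmann K) : partialD K i (partialD K i f) = 0 :=
  CliffordAlgebra.contractLeft_contractLeft _ _

theorem partialD_comm (i j : ℕ) (f : Grassmann K) :
    partialD K i (partialD K j f) = -partialD K j (partialD K i f) :=
  CliffordAlgebra.contractLeft_comm _ _ _

theorem IsMon.partialD_eq_zero (hf : IsMon S f) {n : ℕ} (hn : n ∉ S) : partialD K n f = 0 := by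
  induction hf with
  | scalar c => exact partialD_algebraMap _ _
  | letter_mul i hi _ ih =>
    rw [Finset.mem_insert, not_or] at hn
    rw [partialD_letter_mul_of_ne hn.1, ih hn.2, mul_zero, neg_zero]

theorem IsMon.partialD (hf : IsMon S f) {n : ℕ} (hn : n ∈ S) :
    IsMon (S.erase n) (partialD K n f) := by
  obtain ⟨g, hg, rfl⟩ := hf.exists_letter_mul hn
  rw [partialD_letter_mul_self, hg.partialD_eq_zero (Finset.notMem_erase n S), mul_zero, sub_zero]
  exact hg

theorem IsMon.partialD_mul (hf : IsMon S f) (n : ℕ) (g : Grassmann K) :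
    FractalSuper.partialD K n (f * g)
      = FractalSuper.partialD K n f * g
        + (-1 : K) ^ S.card • (f * FractalSuper.partialD K n g) := by
  induction hf with
  | scalar c =>
    rw [partialD_algebraMap, zero_mul, zero_add, ← Algebra.smul_def, map_smul,
      ← Algebra.smul_def]
    simp
  | @letter_mul S f i hi _ ih =>
    rw [mul_assoc, Finset.card_insert_of_notMem hi, pow_succ, mul_neg_one, neg_smul]
    rcases eq_or_ne n i with rfl | h
    · rw [partialD_letter_mul_self, partialD_letter_mul_self, ih, mul_add, mul_smul_comm, sub_mul,
        mul_assoc, mul_assoc]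
      abel
    · rw [partialD_letter_mul_of_ne h, partialD_letter_mul_of_ne h, ih, mul_add, mul_smul_comm,
        neg_mul, mul_assoc, mul_assoc]
      abel

theorem pivot_eventually_zero (f : Grassmann K) : ∃ N, ∀ n, N ≤ n → pivot K n f = 0 := by
  obtain ⟨N, hN⟩ := partialD_eventually_zero K f
  refine ⟨N, fun n hn => ?_⟩
  change (∑ᶠ l : ℕ, pivotCoeff K n l * partialD K (n + 3 * l) f) = 0
  refine finsum_eq_zero_of_forall_eq_zero fun l => ?_
  rw [hN _ (by omega), mul_zero]

/-- Downward induction along the recursion for the pivot elements. -/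
theorem pivot_induction {P : ℕ → Prop} (h₀ : ∃ N, ∀ n, N ≤ n → P n)
    (step : ∀ n, P (n + 3) → P n) (n : ℕ) : P n := by
  obtain ⟨N, hN⟩ := h₀
  have key : ∀ d n, N ≤ n + d → P n := by
    intro d
    induction d with
    | zero => exact fun n hn => hN n hn
    | succ d ih => exact fun n hn => step n (ih (n + 3) (by omega))
  exact key N n (by omega)

theorem pivot_step (n : ℕ) (f : Grassmann K) :
    pivot K n f = partialD K n f + letter K n * (letter K (n + 1) * pivot K (n + 3) f) := by
  rw [pivot_rec, mul_assoc]

/-- The super Leibniz rule descends along the recursion for `v_n`: both sides vanish for large `n`,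
and the even coefficient `x_n x_{n+1}` commutes with everything it must pass. -/
theorem IsMon.pivot_mul (hf : IsMon S f) (n : ℕ) (g : Grassmann K) :
    pivot K n (f * g) = pivot K n f * g + (-1 : K) ^ S.card • (f * pivot K n g) := by
  refine pivot_induction (P := fun n =>
    pivot K n (f * g) = pivot K n f * g + (-1 : K) ^ S.card • (f * pivot K n g)) ?_ ?_ n
  · obtain ⟨N₁, h₁⟩ := pivot_eventually_zero f
    obtain ⟨N₂, h₂⟩ := pivot_eventually_zero g
    obtain ⟨N₃, h₃⟩ := pivot_eventually_zero (f * g)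
    refine ⟨max N₁ (max N₂ N₃), fun n hn => ?_⟩
    simp only [max_le_iff] at hn
    rw [h₁ n hn.1, h₂ n hn.2.1, h₃ n hn.2.2]
    simp
  · intro n ih
    have hc : f * (letter K n * letter K (n + 1)) = letter K n * letter K (n + 1) * f := by
      rw [(isMon_pair n).mul_comm hf]
      simp
    rw [pivot_rec, pivot_rec K n f, pivot_rec K n g, ih, hf.partialD_mul, mul_add, add_mul, mul_add,
      ← mul_assoc f (letter K n * _), hc, mul_smul_comm, smul_add]
    simp only [mul_assoc]
    abel

theorem IsMon.pivot_eq_zero (hf : IsMon S f) {n : ℕ} (hn : ∀ j ∈ S, j < n) : pivot K n f = 0 := by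
  revert hn
  refine pivot_induction (P := fun n => (∀ j ∈ S, j < n) → pivot K n f = 0) ?_ ?_ n
  · obtain ⟨N, h⟩ := pivot_eventually_zero f
    exact ⟨N, fun n hn _ => h n hn⟩
  · intro n ih hn
    rw [pivot_rec, ih fun j hj => (hn j hj).trans (by omega),
      hf.partialD_eq_zero fun h => lt_irrefl _ (hn n h), mul_zero, add_zero]

theorem IsMon.pivot_mul_of_lt (hf : IsMon S f) {n : ℕ} (hn : ∀ j ∈ S, j < n) (g : Grassmann K) :
    pivot K n (f * g) = (-1 : K) ^ S.card • (f * pivot K n g) := by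
  rw [hf.pivot_mul, hf.pivot_eq_zero hn, zero_mul, zero_add]

theorem pivot_letter_mul_of_lt {i n : ℕ} (h : i < n) (f : Grassmann K) :
    pivot K n (letter K i * f) = -(letter K i * pivot K n f) := by
  rw [(isMon_letter i).pivot_mul_of_lt (by simpa using h)]
  simp

/-- The tail `x_n x_{n+1} v_{n+3}` contributes nothing on either side, because `x_n` would occur
twice; so `v_n` acts here exactly like `∂_n`. -/
theorem pivot_letter_mul_self (n : ℕ) (f : Grassmann K) :
    pivot K n (letter K n * f) = f - letter K n * pivot K n f := by
  rw [pivot_step, pivot_step n f, partialD_letter_mul_self, pivot_letter_mul_of_lt (by omega),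
    mul_add, letter_mul_self_mul, mul_neg, mul_neg, letter_mul_left_comm (n + 1),
    mul_neg, letter_mul_self_mul]
  simp

theorem pivot_letter (n : ℕ) : pivot K n (letter K n) = 1 := by
  have h := pivot_letter_mul_self (K := K) n 1
  have h1 : pivot K n (1 : Grassmann K) = 0 := isMon_one.pivot_eq_zero (by simp)
  rwa [mul_one, h1, mul_zero, sub_zero] at h

/-- The anticommutator of `∂_n` and `v_m` vanishes for `n < m`. -/
theorem partialD_pivot {n m : ℕ} (h : n < m) (f : Grassmann K) :
    partialD K n (pivot K m f) = -pivot K m (partialD K n f) := by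
  revert h
  refine pivot_induction
    (P := fun m => n < m → partialD K n (pivot K m f) = -pivot K m (partialD K n f)) ?_ ?_ m
  · obtain ⟨N₁, h₁⟩ := pivot_eventually_zero f
    obtain ⟨N₂, h₂⟩ := pivot_eventually_zero (partialD K n f)
    refine ⟨max N₁ N₂, fun m hm _ => ?_⟩
    rw [h₁ m (le_of_max_le_left hm), h₂ m (le_of_max_le_right hm), map_zero, neg_zero]
  · intro m ih h
    rw [pivot_step, pivot_step m (partialD K n f), map_add, partialD_comm,
      partialD_letter_mul_of_ne h.ne, partialD_letter_mul_of_ne (by omega), ih (by omega)]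
    simp only [mul_neg, neg_neg, neg_add]

/-- The square `v_n² = x_{n+1} v_{n+3}`. -/
theorem pivot_pivot (n : ℕ) (f : Grassmann K) :
    pivot K n (pivot K n f) = letter K (n + 1) * pivot K (n + 3) f := by
  rw [pivot_step n (pivot K n f), pivot_step n f, map_add, map_add, partialD_partialD,
    partialD_letter_mul_self, partialD_letter_mul_of_ne (by omega), partialD_pivot (by omega),
    pivot_letter_mul_of_lt (by omega), pivot_letter_mul_of_lt (by omega)]
  simp only [mul_neg, neg_neg, mul_add]
  rw [letter_mul_left_comm (n + 1) n, mul_neg, letter_mul_self_mul]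
  simp

/-- The anticommutator of the pivot elements `v_n` and `v_m`. -/
def pivotComm (K : Type*) [Field K] (n m : ℕ) (f : Grassmann K) : Grassmann K :=
  pivot K n (pivot K m f) + pivot K m (pivot K n f)

theorem pivotComm_comm (n m : ℕ) (f : Grassmann K) : pivotComm K n m f = pivotComm K m n f :=
  add_comm _ _

/-- For `m > n + 1` the operator `v_m` anticommutes with `∂_n`, `x_n` and `x_{n+1}`, hence commutes
with the pair `x_n x_{n+1}`. Only the tail of `v_n` interacts with `v_m`, which shrinks the index
gap by three. -/
theorem pivotComm_step {n m : ℕ} (h : n + 1 < m) (f : Grassmann K) :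
    pivotComm K n m f = letter K n * (letter K (n + 1) * pivotComm K (n + 3) m f) := by
  rw [pivotComm, pivotComm, pivot_step n, pivot_step n f, map_add, partialD_pivot (by omega),
    pivot_letter_mul_of_lt (by omega), pivot_letter_mul_of_lt (by omega), mul_add, mul_add]
  simp only [mul_neg, neg_neg]
  abel

/-- Here `v_{n+1}` differentiates the letter `x_{n+1}` in the tail of `v_n`, leaving `x_n v_{n+3}`
up to sign. The remaining term contains `x_{n+1}` times the anticommutator of `v_{n+1}` and
`v_{n+3}`, which already starts with `x_{n+1}`. -/
theorem pivotComm_succ (n : ℕ) (f : Grassmann K) :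
    pivotComm K n (n + 1) f = -(letter K n * pivot K (n + 3) f) := by
  have h : letter K (n + 1) * pivotComm K (n + 3) (n + 1) f = 0 := by
    rw [pivotComm_comm, pivotComm_step (by omega), letter_mul_self_mul]
  rw [pivotComm, mul_add] at h
  rw [pivotComm, pivot_step n, pivot_step n f, map_add, partialD_pivot (by omega),
    pivot_letter_mul_of_lt (by omega), pivot_letter_mul_self, eq_neg_of_add_eq_zero_left h]
  simp only [mul_neg, mul_sub]
  abel

theorem pivotComm_add_two (n : ℕ) (f : Grassmann K) :
    pivotComm K n (n + 2) f
      = -(letter K n * (letter K (n + 1) * (letter K (n + 2) * pivot K (n + 5) f))) := by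
  rw [pivotComm_step (by omega), pivotComm_comm, pivotComm_succ]
  simp only [mul_neg]

theorem pivotComm_self (n : ℕ) (f : Grassmann K) :
    pivotComm K n n f = (2 : K) • letter K (n + 1) * pivot K (n + 3) f := by
  rw [pivotComm, pivot_pivot, two_smul, add_mul]

theorem letter_mul_pivotComm {n m : ℕ} (h : n < m) (f : Grassmann K) :
    letter K n * pivotComm K n m f = 0 := by
  rcases eq_or_ne m (n + 1) with rfl | h'
  · rw [pivotComm_succ, mul_neg, letter_mul_self_mul, neg_zero]
  · rw [pivotComm_step (by omega), letter_mul_self_mul]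

end Derivations

/-! ### Lie monomials and Lie subsuperalgebras inside an associative superalgebra -/

section General

variable {K A : Type*} [Field K] [Ring A] [Algebra K A] {𝒜 : ZMod 2 → Submodule K A}

theorem superComm_natCast (a b : ℕ) (x y : A) :
    superComm (a : ZMod 2) (b : ZMod 2) x y = x * y - (-1) ^ (a * b) * (y * x) := by
  rw [superComm, ZMod.val_natCast, ZMod.val_natCast, neg_one_pow_eq_pow_mod_two,
    neg_one_pow_eq_pow_mod_two (n := a * b), Nat.mul_mod a b]

theorem superComm_swap (α β : ZMod 2) (x y : A) :
    superComm β α y x = -((-1) ^ (α.val * β.val) * superComm α β x y) := by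
  rw [superComm, superComm, mul_comm β.val]
  rcases neg_one_pow_eq_or A (α.val * β.val) with h | h <;> rw [h] <;> noncomm_ring

theorem neg_one_pow_mul_eq_smul (n : ℕ) (a : A) : (-1) ^ n * a = (-1 : K) ^ n • a := by
  rcases Nat.even_or_odd n with h | h <;>
    simp only [h.neg_one_pow, one_mul, neg_one_mul, one_smul, neg_one_smul]

theorem neg_one_pow_mul_mem {L : Submodule K A} {a : A} (n : ℕ) (ha : a ∈ L) :
    (-1) ^ n * a ∈ L := by
  rcases neg_one_pow_eq_or A n with h | h <;> simpa [h] using ha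

theorem superComm_mem_swap {L : Submodule K A} {α β : ZMod 2} {x y : A}
    (h : superComm α β x y ∈ L) : superComm β α y x ∈ L := by
  rw [superComm_swap]
  exact L.neg_mem (neg_one_pow_mul_mem _ h)

/-- The supercommutator as a bilinear map. -/
def superCommBilin (K : Type*) {A : Type*} [Field K] [Ring A] [Algebra K A] (α β : ZMod 2) :
    A →ₗ[K] A →ₗ[K] A :=
  LinearMap.mul K A - (-1 : K) ^ (α.val * β.val) • (LinearMap.mul K A).flip

theorem superCommBilin_apply (α β : ZMod 2) (x y : A) :
    superCommBilin K α β x y = superComm α β x y := by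
  rcases neg_one_pow_eq_or K (α.val * β.val) with h | h <;>
  rcases Nat.even_or_odd (α.val * β.val) with h' | h' <;>
  simp [superCommBilin, superComm, h'.neg_one_pow]

theorem superComm_mem_of_mem_span {B C : Set A} {L : Submodule K A} {α β : ZMod 2}
    (h : ∀ x ∈ B, ∀ y ∈ C, superComm α β x y ∈ L) {x y : A}
    (hx : x ∈ Submodule.span K B) (hy : y ∈ Submodule.span K C) : superComm α β x y ∈ L := by
  rw [← superCommBilin_apply (K := K)]
  exact LinearMap.BilinMap.apply_apply_mem_of_mem_span L B C _
    (fun x hx y hy => by rw [superCommBilin_apply]; exact h x hx y hy) x y hx hy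

theorem superComm_neg_right (α β : ZMod 2) (x y : A) :
    superComm α β x (-y) = -superComm α β x y := by
  rw [superComm, superComm, mul_neg, neg_mul, mul_neg, neg_sub_neg, neg_sub]

theorem superComm_one_one (x y : A) : superComm 1 1 x y = x * y + y * x := by
  rw [superComm, ZMod.val_one]
  simp

theorem superComm_zero_left (β : ZMod 2) (x y : A) : superComm 0 β x y = x * y - y * x := by
  simp [superComm]

theorem superComm_zero_right (α : ZMod 2) (x y : A) : superComm α 0 x y = x * y - y * x := by
  simp [superComm]

/-- `[m², b] = [m, [m, b]]` for odd `m`. -/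
theorem superComm_sq_left (β : ZMod 2) (m b : A) :
    superComm 0 β (m * m) b = superComm 1 (1 + β) m (superComm 1 β m b) := by
  have h01 : ∀ γ : ZMod 2, γ = 0 ∨ γ = 1 := by decide
  rcases h01 β with rfl | rfl
  · rw [add_zero, superComm_one_one, superComm_zero_right, superComm_zero_right]
    noncomm_ring
  · rw [show (1 : ZMod 2) + 1 = 0 from rfl, superComm_one_one, superComm_zero_right,
      superComm_zero_left]
    noncomm_ring

/-- Squaring of odd elements is quadratic with polarization the supercommutator, so closure need
only be tested on a spanning set, even in characteristic 2. -/
theorem sq_mem_of_mem_span {B : Set A} {L : Submodule K A} (hsq : ∀ x ∈ B, x * x ∈ L)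
    (hcomm : ∀ x ∈ B, ∀ y ∈ B, superComm 1 1 x y ∈ L) {x : A} (hx : x ∈ Submodule.span K B) :
    x * x ∈ L := by
  induction hx using Submodule.span_induction with
  | mem x h => exact hsq x h
  | zero => simp
  | add x y hx hy ihx ihy =>
    have h := superComm_mem_of_mem_span hcomm hx hy
    rw [superComm_one_one] at h
    rw [show (x + y) * (x + y) = x * x + y * y + (x * y + y * x) by noncomm_ring]
    exact L.add_mem (L.add_mem ihx ihy) h
  | smul c x _ ih =>
    rw [smul_mul_smul_comm]
    exact L.smul_mem _ ih

variable (𝒜) in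
/-- The two homogeneous components form a superalgebra grading, except that they need not span. -/
structure IsSuperGrading : Prop where
  mul_mem : ∀ {α β : ZMod 2} {a b : A}, a ∈ 𝒜 α → b ∈ 𝒜 β → a * b ∈ 𝒜 (α + β)
  disjoint : Disjoint (𝒜 0) (𝒜 1)

theorem IsSuperGrading.superComm_mem (h𝒜 : IsSuperGrading 𝒜) {α β : ZMod 2} {a b : A}
    (ha : a ∈ 𝒜 α) (hb : b ∈ 𝒜 β) : superComm α β a b ∈ 𝒜 (α + β) := by
  refine Submodule.sub_mem _ (h𝒜.mul_mem ha hb) (neg_one_pow_mul_mem _ ?_)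
  rw [add_comm]
  exact h𝒜.mul_mem hb ha

theorem IsSuperGrading.mem_span_of_mem_sup (h𝒜 : IsSuperGrading 𝒜) {B : ZMod 2 → Submodule K A}
    (hB : ∀ α, B α ≤ 𝒜 α) {α : ZMod 2} {a : A} (ha : a ∈ B 0 ⊔ B 1) (haα : a ∈ 𝒜 α) :
    a ∈ B α := by
  obtain ⟨x, hx, y, hy, rfl⟩ := Submodule.mem_sup.mp ha
  have h01 : ∀ γ : ZMod 2, γ = 0 ∨ γ = 1 := by decide
  rcases h01 α with rfl | rfl
  · have h : y ∈ 𝒜 0 := by simpa using Submodule.sub_mem _ haα (hB 0 hx)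
    rw [Submodule.disjoint_def.mp h𝒜.disjoint y h (hB 1 hy), add_zero]
    exact hx
  · have h : x ∈ 𝒜 1 := by simpa using Submodule.sub_mem _ haα (hB 1 hy)
    rw [Submodule.disjoint_def.mp h𝒜.disjoint x (hB 0 hx) h, zero_add]
    exact hy

theorem IsSuperGrading.isLieSubsuperalgebra_sup (h𝒜 : IsSuperGrading 𝒜) {B : ZMod 2 → Set A}
    (hB : ∀ α, B α ⊆ 𝒜 α)
    (hcomm : ∀ α β, ∀ x ∈ B α, ∀ y ∈ B β, superComm α β x y ∈ Submodule.span K (B (α + β)))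
    (hsq : ∀ x ∈ B 1, x * x ∈ Submodule.span K (B 0)) :
    IsLieSubsuperalgebra 𝒜 (Submodule.span K (B 0) ⊔ Submodule.span K (B 1)) := by
  have hB' : ∀ α, Submodule.span K (B α) ≤ 𝒜 α := fun α => Submodule.span_le.mpr (hB α)
  have hle : ∀ α, Submodule.span K (B α) ≤ Submodule.span K (B 0) ⊔ Submodule.span K (B 1) := by
    have h01 : ∀ γ : ZMod 2, γ = 0 ∨ γ = 1 := by decide
    intro α
    rcases h01 α with rfl | rfl
    · exact le_sup_left
    · exact le_sup_right
  have hmem : ∀ {α : ZMod 2} {a : A},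
      a ∈ (Submodule.span K (B 0) ⊔ Submodule.span K (B 1)) ⊓ 𝒜 α → a ∈ Submodule.span K (B α) :=
    fun ha => h𝒜.mem_span_of_mem_sup (B := fun α => Submodule.span K (B α)) hB' ha.1 ha.2
  refine ⟨fun a ha => ?_, fun α β a b ha hb => ?_, fun a ha => ?_⟩
  · obtain ⟨x, hx, y, hy, rfl⟩ := Submodule.mem_sup.mp ha
    exact ⟨x, ⟨hle 0 hx, hB' 0 hx⟩, y, ⟨hle 1 hy, hB' 1 hy⟩, rfl⟩
  · exact hle (α + β) (superComm_mem_of_mem_span (hcomm α β) (hmem ha) (hmem hb))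
  · exact hle 0 (sq_mem_of_mem_span hsq (hcomm 1 1) (hmem ha))

theorem IsSuperGrading.isLieMonomial_mem (h𝒜 : IsSuperGrading 𝒜) {X : Set A} {n : ℕ} {α : ZMod 2}
    {m : A} (hm : IsLieMonomial 𝒜 X n α m) : m ∈ 𝒜 α := by
  induction hm with
  | gen _ h => exact h
  | bracket _ _ iha ihb => exact h𝒜.superComm_mem iha ihb

variable (𝒜) in
/-- The Lie monomials of parity `α`, together with the squares of odd Lie monomials if `α` is
even. -/
def lieMonomialsAndSquares (X : Set A) (α : ZMod 2) : Set A :=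
  {m | ∃ n, IsLieMonomial 𝒜 X n α m} ∪
    {s | α = 0 ∧ ∃ n m, IsLieMonomial 𝒜 X n 1 m ∧ s = m * m}

/-- Adjoining squares of odd monomials is enough: `[m², b] = [m, [m, b]]` turns every bracket with a
square back into a combination of monomials. Thus this span contains all of `Lie(X)`, and its odd
part needs no squares. -/
theorem IsSuperGrading.isLieSubsuperalgebra_lieMonomials (h𝒜 : IsSuperGrading 𝒜) (X : Set A) :
    IsLieSubsuperalgebra 𝒜 (Submodule.span K (lieMonomialsAndSquares 𝒜 X 0) ⊔
      Submodule.span K (lieMonomialsAndSquares 𝒜 X 1)) := by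
  have h11 : (1 : ZMod 2) + 1 = 0 := rfl
  have hsqleft : ∀ {n k : ℕ} {β : ZMod 2} {m b : A}, IsLieMonomial 𝒜 X n 1 m →
      IsLieMonomial 𝒜 X k β b → ∃ l, IsLieMonomial 𝒜 X l β (superComm 0 β (m * m) b) := by
    intro n k β m b hm hb
    have h := hm.bracket (hm.bracket hb)
    rw [← superComm_sq_left, ← add_assoc (1 : ZMod 2), h11, zero_add] at h
    exact ⟨_, h⟩
  have hleft : ∀ {n : ℕ} {β : ZMod 2} {m b : A}, IsLieMonomial 𝒜 X n 1 m →
      (∃ k, IsLieMonomial 𝒜 X k β b) →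
      superComm 0 β (m * m) b ∈ Submodule.span K (lieMonomialsAndSquares 𝒜 X (0 + β)) := by
    rintro n β m b hm ⟨k, hb⟩
    obtain ⟨l, hl⟩ := hsqleft hm hb
    rw [zero_add]
    exact Submodule.subset_span (Or.inl ⟨l, hl⟩)
  refine h𝒜.isLieSubsuperalgebra_sup ?_ ?_ ?_
  · rintro α x (⟨n, h⟩ | ⟨rfl, n, m, hm, rfl⟩)
    · exact h𝒜.isLieMonomial_mem h
    · exact h𝒜.mul_mem (h𝒜.isLieMonomial_mem hm) (h𝒜.isLieMonomial_mem hm)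
  · rintro α β x (⟨n, hx⟩ | ⟨rfl, n, m, hm, rfl⟩) y (⟨k, hy⟩ | ⟨rfl, k, b, hb, rfl⟩)
    · exact Submodule.subset_span (Or.inl ⟨_, hx.bracket hy⟩)
    · rw [add_comm]
      exact superComm_mem_swap (hleft hb ⟨n, hx⟩)
    · exact hleft hm ⟨k, hy⟩
    · obtain ⟨l, hl⟩ := hsqleft hb hm
      have h := superComm_mem_swap (K := K) (L := Submodule.span K
        (lieMonomialsAndSquares 𝒜 X 0)) (α := 1) (β := 1)
        (x := superComm 0 1 (b * b) m) (y := m)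
        (Submodule.subset_span (Or.inl ⟨_, hl.bracket hm⟩))
      have h2 := Submodule.neg_mem _ h
      rw [superComm_sq_left, add_zero, add_zero]
      convert h2 using 1
      rw [superComm_one_one, superComm_one_one, superComm_zero_right, superComm_zero_left]
      noncomm_ring
  · intro x hx
    rcases hx with ⟨n, h⟩ | ⟨h, -⟩
    · exact Submodule.subset_span (Or.inr ⟨rfl, n, x, h, rfl⟩)
    · exact absurd h one_ne_zero

variable (𝒜) in
/-- The span of the Lie monomials of parity `α` and length at most the real number `t`. -/
def lieSpan (X : Set A) (t : ℝ) (α : ZMod 2) : Submodule K A :=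
  Submodule.span K {m | ∃ n : ℕ, (n : ℝ) ≤ t ∧ IsLieMonomial 𝒜 X n α m}

theorem lieSpan_mono {X : Set A} {s t : ℝ} (h : s ≤ t) (α : ZMod 2) :
    lieSpan 𝒜 X s α ≤ lieSpan 𝒜 X t α :=
  Submodule.span_mono fun _ ⟨n, hn, hm⟩ => ⟨n, hn.trans h, hm⟩

theorem superComm_mem_lieSpan {X : Set A} {s t : ℝ} {α β : ZMod 2} {a b : A}
    (ha : a ∈ lieSpan 𝒜 X s α) (hb : b ∈ lieSpan 𝒜 X t β) :
    superComm α β a b ∈ lieSpan 𝒜 X (s + t) (α + β) := by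
  refine superComm_mem_of_mem_span ?_ ha hb
  rintro x ⟨n, hn, hx⟩ y ⟨k, hk, hy⟩
  exact Submodule.subset_span ⟨n + k, by push_cast; exact add_le_add hn hk, hx.bracket hy⟩

theorem lieSpan_le_growthSpace {X : Set A} {t : ℝ} {n : ℕ} (h : t ≤ n) (α : ZMod 2) :
    lieSpan 𝒜 X t α ≤ growthSpace 𝒜 X n :=
  Submodule.span_mono fun _ ⟨k, hk, hm⟩ => Or.inl ⟨k, by exact_mod_cast hk.trans h, α, hm⟩

/-- An odd element of the generated Lie superalgebra is a combination of odd Lie monomials. -/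
theorem IsSuperGrading.exists_mem_lieSpan (h𝒜 : IsSuperGrading 𝒜) {X : Set A}
    (hX : ∀ x ∈ X, ∃ α, x ∈ 𝒜 α) {a : A} (ha : a ∈ lieSuper 𝒜 X) (hodd : a ∈ 𝒜 1) :
    ∃ N : ℕ, a ∈ lieSpan 𝒜 X N 1 := by
  have hU := h𝒜.isLieSubsuperalgebra_lieMonomials X
  have h1 : a ∈ Submodule.span K (lieMonomialsAndSquares 𝒜 X 0) ⊔
      Submodule.span K (lieMonomialsAndSquares 𝒜 X 1) := by
    refine Submodule.mem_sInf.mp ha _ ⟨fun x hx => ?_, hU⟩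
    obtain ⟨α, hα⟩ := hX x hx
    have h01 : ∀ γ : ZMod 2, γ = 0 ∨ γ = 1 := by decide
    rcases h01 α with rfl | rfl
    · exact Submodule.mem_sup_left (Submodule.subset_span (Or.inl ⟨1, .gen hx hα⟩))
    · exact Submodule.mem_sup_right (Submodule.subset_span (Or.inl ⟨1, .gen hx hα⟩))
  have h2 : a ∈ Submodule.span K (lieMonomialsAndSquares 𝒜 X 1) := by
    refine h𝒜.mem_span_of_mem_sup
      (B := fun α => Submodule.span K (lieMonomialsAndSquares 𝒜 X α)) ?_ h1 hodd
    intro α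
    refine Submodule.span_le.mpr ?_
    rintro x (⟨n, h⟩ | ⟨rfl, n, m, hm, rfl⟩)
    · exact h𝒜.isLieMonomial_mem h
    · exact h𝒜.mul_mem (h𝒜.isLieMonomial_mem hm) (h𝒜.isLieMonomial_mem hm)
  clear ha hodd h1
  induction h2 using Submodule.span_induction with
  | mem x h =>
    rcases h with ⟨n, h⟩ | ⟨h, -⟩
    · exact ⟨n, Submodule.subset_span ⟨n, le_rfl, h⟩⟩
    · exact absurd h one_ne_zero
  | zero => exact ⟨0, Submodule.zero_mem _⟩
  | add x y _ _ ihx ihy =>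
    obtain ⟨N, hN⟩ := ihx
    obtain ⟨M, hM⟩ := ihy
    exact ⟨max N M, Submodule.add_mem _
      (lieSpan_mono (by exact_mod_cast le_max_left N M) _ hN)
      (lieSpan_mono (by exact_mod_cast le_max_right N M) _ hM)⟩
  | smul c x _ ih =>
    obtain ⟨N, hN⟩ := ih
    exact ⟨N, Submodule.smul_mem _ c hN⟩

end General

/-! ### Brackets of monomial superderivations -/

section Brackets

variable {K : Type*} [Field K] {S T : Finset ℕ} {f g : Grassmann K}

/-- The superderivation `f v_n`, linear in `f`. -/
def pivotTerm (n : ℕ) : Grassmann K →ₗ[K] Module.End K (Grassmann K) :=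
  (LinearMap.mul K (Module.End K (Grassmann K))).flip (pivot K n) ∘ₗ LinearMap.mul K (Grassmann K)

@[simp]
theorem pivotTerm_apply (n : ℕ) (f x : Grassmann K) : pivotTerm n f x = f * pivot K n x := rfl

theorem pivotTerm_one (n : ℕ) : pivotTerm n (1 : Grassmann K) = pivot K n :=
  LinearMap.ext fun x => by simp

/-- As `v_m` kills `f`, only one derivative term survives, `f v_n(g) v_m`; the other summand is the
anticommutator of the pivot elements with coefficient `f g` up to sign. -/
theorem superComm_pivotTerm_apply (hf : IsMon S f) (hg : IsMon T g) {n m : ℕ}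
    (hS : ∀ j ∈ S, j < m) (x : Grassmann K) :
    superComm ((S.card + 1 : ℕ) : ZMod 2) ((T.card + 1 : ℕ) : ZMod 2) (pivotTerm n f)
        (pivotTerm m g) x
      = f * pivot K n g * pivot K m x + (-1 : K) ^ T.card • (f * g * pivotComm K n m x) := by
  have hsgn : (-1 : K) ^ ((S.card + 1) * (T.card + 1)) * (-1) ^ S.card * (-1) ^ (S.card * T.card)
      = -(-1) ^ T.card := by
    have : (S.card + 1) * (T.card + 1) + S.card + S.card * T.card
        = 2 * (S.card * T.card + S.card) + T.card + 1 := by ring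
    rw [← pow_add, ← pow_add, this, pow_succ, pow_add, pow_mul]
    simp
  rw [superComm_natCast, LinearMap.sub_apply, neg_one_pow_mul_eq_smul (K := K), LinearMap.smul_apply]
  simp only [Module.End.mul_apply, pivotTerm_apply]
  rw [hg.pivot_mul, hf.pivot_mul_of_lt hS, pivotComm, mul_smul_comm, ← mul_assoc g f,
    hf.mul_comm hg, smul_mul_assoc, smul_smul, smul_smul, hsgn, mul_add, mul_smul_comm, mul_add,
    smul_add, neg_smul, sub_neg_eq_add, mul_assoc, mul_assoc, mul_assoc, add_assoc]

theorem pivotTerm_mul_self_apply (hf : IsMon S f) {n : ℕ} (hS : ∀ j ∈ S, j < n) (x : Grassmann K) :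
    (pivotTerm n f * pivotTerm n f) x
      = (-1 : K) ^ S.card • (f * f * (letter K (n + 1) * pivot K (n + 3) x)) := by
  rw [Module.End.mul_apply, pivotTerm_apply, pivotTerm_apply, hf.pivot_mul_of_lt hS, pivot_pivot,
    mul_smul_comm, mul_assoc]

end Brackets

/-! ### The monomial superderivations that occur in `Q` -/

section Upper

variable {K : Type*} [Field K] {S T : Finset ℕ} {f g : Grassmann K} {lam : ℝ}

/-- The monomials `x_S` for which `x_S v_n` may occur in `Q`: all letters are at most `x_{n-2}`, and
not both of `x_{n-3}`, `x_{n-2}` occur. -/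
def Admissible (n : ℕ) (S : Finset ℕ) : Prop :=
  (∀ j ∈ S, j + 2 ≤ n) ∧ ∀ j ∈ S, j + 3 = n → j + 1 ∉ S

/-- The total weight of the letters in `S`, up to sign. -/
def letterWeight (lam : ℝ) (S : Finset ℕ) : ℝ := ∑ j ∈ S, lam ^ j

theorem letterWeight_union (h : Disjoint S T) :
    letterWeight lam (S ∪ T) = letterWeight lam S + letterWeight lam T :=
  Finset.sum_union h

theorem letterWeight_erase {n : ℕ} (h : n ∈ S) :
    letterWeight lam (S.erase n) = letterWeight lam S - lam ^ n := by
  rw [letterWeight, letterWeight, ← Finset.add_sum_erase S _ h]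
  ring

theorem Admissible.union {n : ℕ} (hS : Admissible n S) (hT : ∀ j ∈ T, j + 4 ≤ n) :
    Admissible n (T ∪ S) := by
  refine ⟨fun j hj => ?_, fun j hj hjn hj' => ?_⟩
  · rcases Finset.mem_union.mp hj with h | h
    · have := hT j h
      omega
    · exact hS.1 j h
  · rcases Finset.mem_union.mp hj with h | h
    · have := hT j h
      omega
    · rcases Finset.mem_union.mp hj' with h' | h'
      · have := hT _ h'
        omega
      · exact hS.2 j h hjn h'

/-- This is the homogeneity of `v_n = ∂_n + x_n x_{n+1} v_{n+3}`, and also the length of `[v_n,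
[v_n, v_{n+1}]]`, the bracket that yields `v_{n+3}`. -/
theorem weight_rec (hlam : lam ^ 3 = lam + 2) (n : ℕ) :
    lam ^ (n + 3) = 2 * lam ^ n + lam ^ (n + 1) := by
  rw [pow_add, hlam, pow_succ]
  ring

/-- The elements of `Λ` that are multiples of an admissible monomial of given weight and parity. -/
def admissibleMonomials (K : Type*) [Field K] (lam : ℝ) (m : ℕ) (w : ℝ) (α : ZMod 2) :
    Set (Grassmann K) :=
  {h | ∃ S, IsMon S h ∧ Admissible m S ∧ letterWeight lam S = w ∧ (S.card : ZMod 2) = α}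

/-- Either `v_n` removes `x_n`, or it passes to `v_{n+3}` and inserts `x_n x_{n+1}`; both lower the
total letter weight by `λ^n` and flip the parity. -/
theorem pivot_mem_span_admissible (hlam : lam ^ 3 = lam + 2) (hg : IsMon T g) {m : ℕ}
    (hT : Admissible m T) (n : ℕ) :
    pivot K n g ∈ Submodule.span K
      (admissibleMonomials K lam m (letterWeight lam T - lam ^ n) (T.card + 1)) := by
  refine pivot_induction (P := fun n => pivot K n g ∈ Submodule.span K
      (admissibleMonomials K lam m (letterWeight lam T - lam ^ n) (T.card + 1))) ?_ ?_ n
  · obtain ⟨N, hN⟩ := pivot_eventually_zero g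
    exact ⟨N, fun n hn => by rw [hN n hn]; exact Submodule.zero_mem _⟩
  · intro n ih
    rw [pivot_rec]
    refine Submodule.add_mem _ ?_ ?_
    · by_cases hn : n ∈ T
      · refine Submodule.subset_span ⟨T.erase n, hg.partialD hn, ⟨fun j hj => ?_, fun j hj hjm h => ?_⟩,
          letterWeight_erase hn, ?_⟩
        · exact hT.1 j (Finset.mem_of_mem_erase hj)
        · exact hT.2 j (Finset.mem_of_mem_erase hj) hjm (Finset.mem_of_mem_erase h)
        · rw [← Finset.card_erase_add_one hn, Nat.cast_succ, add_assoc,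
            show (1 : ZMod 2) + 1 = 0 from rfl, add_zero]
      · rw [hg.partialD_eq_zero hn]
        exact Submodule.zero_mem _
    -- If `m ≤ n + 4`, the letters of `g` lie below `n + 3` and the tail vanishes. Otherwise the
    -- inserted letters are at most `x_{m-4}`, too low to affect admissibility.
    · rcases le_or_gt m (n + 4) with hm | hm
      · rw [hg.pivot_eq_zero fun j hj => by have := hT.1 j hj; omega, mul_zero]
        exact Submodule.zero_mem _
      · rw [← LinearMap.mulLeft_apply (R := K)]
        refine Submodule.span_induction
          (p := fun h _ => LinearMap.mulLeft K (letter K n * letter K (n + 1)) h ∈ Submodule.span K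
            (admissibleMonomials K lam m (letterWeight lam T - lam ^ n) (T.card + 1)))
          ?_ ?_ ?_ ?_ ih
        · rintro h ⟨S, hS, hadm, hw, hc⟩
          rw [LinearMap.mulLeft_apply]
          rcases (isMon_pair n).mul_cases hS with ⟨hd, hmon⟩ | h0
          · refine Submodule.subset_span ⟨_, hmon, hadm.union ?_, ?_, ?_⟩
            · intro j hj
              simp only [Finset.mem_insert, Finset.mem_singleton] at hj
              omega
            · rw [letterWeight_union hd, hw, weight_rec hlam, letterWeight,
                Finset.sum_pair (by omega)]
              ring
            · rw [Finset.card_union_of_disjoint hd, Finset.card_pair (by omega), Nat.cast_add, hc,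
                show ((2 : ℕ) : ZMod 2) = 0 from rfl, zero_add]
          · rw [h0]
            exact Submodule.zero_mem _
        · rw [map_zero]
          exact Submodule.zero_mem _
        · intro x y _ _ hx hy
          rw [map_add]
          exact Submodule.add_mem _ hx hy
        · intro c x _ hx
          rw [map_smul]
          exact Submodule.smul_mem _ c hx

/-- The anticommutator of two pivot elements is again a monomial superderivation. -/
theorem exists_pivotComm_eq (K : Type*) [Field K] (hlam : lam ^ 3 = lam + 2) (d : ℕ) :
    ∀ n : ℕ, ∃ (N : ℕ) (S : Finset ℕ) (h : Grassmann K), n + d + 2 ≤ N ∧ (∀ j ∈ S, n ≤ j) ∧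
      Admissible N S ∧ IsMon S h ∧ lam ^ N - letterWeight lam S = lam ^ n + lam ^ (n + d) ∧
      (S.card : ZMod 2) = 1 ∧ ∀ x, pivotComm K n (n + d) x = h * pivot K N x := by
  induction d using Nat.strong_induction_on with
  | _ d ih =>
    intro n
    -- Gaps 0, 1, 2 are explicit, and larger gaps drop by three. For gap 0 the coefficient 2 may
    -- vanish in `K`, which is harmless since `IsMon` admits zero multiples.
    match d, ih with
    | 0, _ =>
      refine ⟨n + 3, {n + 1}, (2 : K) • letter K (n + 1), by omega, by simp,
        ⟨by simp, by simp⟩, (isMon_letter _).smul 2, ?_, by simp, pivotComm_self n⟩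
      rw [weight_rec hlam, letterWeight, Finset.sum_singleton]
      ring
    | 1, _ =>
      refine ⟨n + 3, {n}, -letter K n, by omega, by simp, ⟨by simp, by simp⟩,
        (isMon_letter _).neg, ?_, by simp, fun x => by rw [pivotComm_succ, neg_mul]⟩
      rw [weight_rec hlam, letterWeight, Finset.sum_singleton]
      ring
    | 2, _ =>
      refine ⟨n + 5, {n, n + 1, n + 2}, -(letter K n * (letter K (n + 1) * letter K (n + 2))),
        by omega, ?_, ⟨?_, ?_⟩,
        (IsMon.letter_mul n (by simp [add_assoc]) (isMon_pair (n + 1))).neg, ?_, ?_, ?_⟩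
      · intro j hj
        simp only [Finset.mem_insert, Finset.mem_singleton] at hj
        omega
      · intro j hj
        simp only [Finset.mem_insert, Finset.mem_singleton] at hj
        omega
      · intro j hj
        simp only [Finset.mem_insert, Finset.mem_singleton] at hj ⊢
        omega
      · rw [letterWeight, Finset.sum_insert (by simp), Finset.sum_pair (by omega),
          show n + 5 = n + 2 + 3 by ring, weight_rec hlam, show n + 2 + 1 = n + 3 by ring,
          weight_rec hlam]
        ring
      · rw [Finset.card_insert_of_notMem (by simp), Finset.card_pair (by omega)]
        rfl
      · intro x
        rw [pivotComm_add_two]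
        simp only [neg_mul, mul_assoc]
    | d + 3, ih =>
      obtain ⟨N, S, h, hN, hS, hadm, hmon, hw, hc, hx⟩ := ih d (by omega) (n + 3)
      have hd : Disjoint {n, n + 1} S := by
        rw [Finset.disjoint_left]
        intro j hj hj'
        have := hS j hj'
        simp only [Finset.mem_insert, Finset.mem_singleton] at hj
        omega
      rw [show n + (d + 3) = n + 3 + d by ring]
      refine ⟨N, {n, n + 1} ∪ S, letter K n * letter K (n + 1) * h, by omega, ?_, ?_, ?_, ?_, ?_, ?_⟩
      · intro j hj
        rcases Finset.mem_union.mp hj with h | h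
        · simp only [Finset.mem_insert, Finset.mem_singleton] at h
          omega
        · have := hS j h
          omega
      · refine hadm.union fun j hj => ?_
        simp only [Finset.mem_insert, Finset.mem_singleton] at hj
        omega
      · rw [mul_assoc, Finset.insert_union, Finset.singleton_union]
        have h1 : n + 1 ∉ S := fun h => by have := hS _ h; omega
        have h0 : n ∉ insert (n + 1) S := fun h => by
          rcases Finset.mem_insert.mp h with h | h
          · omega
          · have := hS _ h
            omega
        exact .letter_mul n h0 (.letter_mul (n + 1) h1 hmon)
      · rw [letterWeight_union hd, letterWeight, Finset.sum_pair (by omega), ← sub_sub,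
          sub_right_comm, hw, weight_rec hlam]
        ring
      · rw [Finset.card_union_of_disjoint hd, Finset.card_pair (by omega), Nat.cast_add, hc]
        rfl
      · intro x
        rw [pivotComm_step (by omega), hx]
        simp only [mul_assoc]

/-- The admissible monomial superderivations of parity `α` and weight at most `t`. -/
def pivotMonomials (K : Type*) [Field K] (lam t : ℝ) (α : ZMod 2) :
    Set (Module.End K (Grassmann K)) :=
  {φ | ∃ n S f, IsMon S f ∧ Admissible n S ∧ lam ^ n - letterWeight lam S ≤ t ∧
    ((S.card + 1 : ℕ) : ZMod 2) = α ∧ φ = pivotTerm n f}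

theorem pivotMonomials_mono {s t : ℝ} (h : s ≤ t) (α : ZMod 2) :
    pivotMonomials K lam s α ⊆ pivotMonomials K lam t α :=
  fun _ ⟨n, S, f, hf, hS, hw, hc, hφ⟩ => ⟨n, S, f, hf, hS, hw.trans h, hc, hφ⟩

/-- The admissibility condition is chosen to be stable here: new factors in front of a head `v_N`
always have letters at most `x_{N-4}`. -/
theorem superComm_pivotTerm_mem (hlam : lam ^ 3 = lam + 2) {n m : ℕ} (hnm : n ≤ m)
    (hf : IsMon S f) (hS : Admissible n S) (hg : IsMon T g) (hT : Admissible m T) {s t : ℝ}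
    (hs : lam ^ n - letterWeight lam S ≤ s) (ht : lam ^ m - letterWeight lam T ≤ t) :
    superComm ((S.card + 1 : ℕ) : ZMod 2) ((T.card + 1 : ℕ) : ZMod 2) (pivotTerm n f)
        (pivotTerm m g) ∈
      Submodule.span K (pivotMonomials K lam (s + t)
        (((S.card + 1 : ℕ) : ZMod 2) + ((T.card + 1 : ℕ) : ZMod 2))) := by
  have h11 : ∀ a b : ZMod 2, a + 1 + (b + 1) = a + (b + 1) + 1 := by decide
  have h12 : ∀ a b : ZMod 2, a + 1 + (b + 1) = a + b + 1 + 1 := by decide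
  have hSm : ∀ j ∈ S, j < m := fun j hj => by have := hS.1 j hj; omega
  obtain ⟨d, rfl⟩ := Nat.exists_eq_add_of_le hnm
  obtain ⟨N, R, h, hN, hR, hRadm, hmon, hw, hc, hx⟩ := exists_pivotComm_eq K hlam d n
  have key : superComm ((S.card + 1 : ℕ) : ZMod 2) ((T.card + 1 : ℕ) : ZMod 2) (pivotTerm n f)
        (pivotTerm (n + d) g) = pivotTerm (n + d) (f * pivot K n g)
          + (-1 : K) ^ T.card • pivotTerm N (f * g * h) := by
    refine LinearMap.ext fun x => ?_
    rw [superComm_pivotTerm_apply hf hg hSm, hx]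
    simp [mul_assoc]
  rw [key]
  refine Submodule.add_mem _ ?_ (Submodule.smul_mem _ _ ?_)
  -- If `m ≥ n + 2`, the letters of `f` are at most `x_{n-2}`, hence at most `x_{m-4}`. If `m ≤ n +
  -- 1`, all letters of `g` lie below `n`, so `v_n(g) = 0`.
  · rcases Nat.lt_or_ge (n + 1) (n + d) with hd | hd
    · refine Submodule.span_induction (p := fun h _ => pivotTerm (n + d) (f * h) ∈ _)
        ?_ ?_ ?_ ?_ (pivot_mem_span_admissible hlam hg hT n)
      · rintro h ⟨U, hU, hadm, hw, hc⟩
        rcases hf.mul_cases hU with ⟨hd, hmon⟩ | h0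
        · refine Submodule.subset_span ⟨n + d, S ∪ U, f * h, hmon, hadm.union ?_, ?_, ?_, rfl⟩
          · intro j hj
            have := hS.1 j hj
            omega
          · rw [letterWeight_union hd, hw]
            linarith
          · rw [Finset.card_union_of_disjoint hd]
            push_cast
            rw [hc, h11]
        · rw [h0, map_zero]
          exact Submodule.zero_mem _
      · rw [mul_zero, map_zero]
        exact Submodule.zero_mem _
      · intro x y _ _ hx hy
        rw [mul_add, map_add]
        exact Submodule.add_mem _ hx hy
      · intro c x _ hx
        rw [mul_smul_comm, map_smul]
        exact Submodule.smul_mem _ c hx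
    · rw [hg.pivot_eq_zero fun j hj => by have := hT.1 j hj; omega, mul_zero, map_zero]
      exact Submodule.zero_mem _
  -- The new head has `N ≥ m + 2`, so the letters of `f` and `g` are at most `x_{N-4}`.
  · rcases hf.mul_cases hg with ⟨hd, hfg⟩ | h0
    · rcases hfg.mul_cases hmon with ⟨hd', hfgh⟩ | h0
      · refine Submodule.subset_span ⟨N, _, _, hfgh, hRadm.union ?_, ?_, ?_, rfl⟩
        · intro j hj
          rcases Finset.mem_union.mp hj with h | h
          · have := hS.1 j h
            omega
          · have := hT.1 j h
            omega
        · rw [letterWeight_union hd', letterWeight_union hd]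
          linarith
        · rw [Finset.card_union_of_disjoint hd', Finset.card_union_of_disjoint hd]
          push_cast
          rw [hc, h12]
      · rw [h0, map_zero]
        exact Submodule.zero_mem _
    · rw [h0, zero_mul, map_zero]
      exact Submodule.zero_mem _

theorem superComm_pivotMonomials_mem (hlam : lam ^ 3 = lam + 2) {s t : ℝ} {α β : ZMod 2}
    {φ ψ : Module.End K (Grassmann K)} (hφ : φ ∈ pivotMonomials K lam s α)
    (hψ : ψ ∈ pivotMonomials K lam t β) :
    superComm α β φ ψ ∈ Submodule.span K (pivotMonomials K lam (s + t) (α + β)) := by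
  obtain ⟨n, S, f, hf, hS, hs, rfl, rfl⟩ := hφ
  obtain ⟨m, T, g, hg, hT, ht, rfl, rfl⟩ := hψ
  rcases le_total n m with h | h
  · exact superComm_pivotTerm_mem hlam h hf hS hg hT hs ht
  · have := superComm_pivotTerm_mem hlam h hg hT hf hS ht hs
    rw [add_comm s, add_comm (((S.card + 1 : ℕ) : ZMod 2))]
    exact superComm_mem_swap this

theorem pivotMonomials_sq_mem (hlam : lam ^ 3 = lam + 2) {t : ℝ} {α : ZMod 2}
    {φ : Module.End K (Grassmann K)} (hφ : φ ∈ pivotMonomials K lam t α) :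
    φ * φ ∈ Submodule.span K (pivotMonomials K lam (t + t) 0) := by
  obtain ⟨n, S, f, hf, hS, hs, rfl, rfl⟩ := hφ
  have hSn : ∀ j ∈ S, j < n := fun j hj => by have := hS.1 j hj; omega
  have key : pivotTerm n f * pivotTerm n f
      = (-1 : K) ^ S.card • pivotTerm (n + 3) (f * f * letter K (n + 1)) := by
    refine LinearMap.ext fun x => ?_
    rw [pivotTerm_mul_self_apply hf hSn]
    simp [mul_assoc]
  rw [key]
  refine Submodule.smul_mem _ _ ?_
  rcases S.eq_empty_or_nonempty with rfl | hne
  · have hmon : IsMon {n + 1} (f * f * letter K (n + 1)) := by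
      rcases hf.mul_cases hf with ⟨-, h⟩ | h
      · rcases h.mul_cases (isMon_letter (n + 1)) with ⟨-, h'⟩ | h'
        · simpa using h'
        · simpa [h'] using (isMon_letter (K := K) (n + 1)).smul 0
      · simpa [h] using (isMon_letter (K := K) (n + 1)).smul 0
    refine Submodule.subset_span ⟨n + 3, {n + 1}, _, hmon, ⟨by simp, by simp⟩, ?_,
      by rw [Finset.card_singleton]; rfl, rfl⟩
    rw [weight_rec hlam, letterWeight, Finset.sum_singleton]
    simp only [letterWeight, Finset.sum_empty] at hs
    linarith
  · rw [hf.mul_self_eq_zero hne, zero_mul, map_zero]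
    exact Submodule.zero_mem _

theorem pivotTerm_mem_endGrading (hf : IsMon S f) (n : ℕ) :
    pivotTerm n f ∈ endGrading K ((S.card + 1 : ℕ) : ZMod 2) := by
  intro β x hx
  rw [Nat.cast_succ, add_assoc]
  exact SetLike.mul_mem_graded hf.mem_evenOdd (pivot_odd K n β x hx)

theorem pivotMonomials_subset_endGrading (t : ℝ) (α : ZMod 2) :
    pivotMonomials K lam t α ⊆ endGrading K α := by
  rintro _ ⟨n, S, f, hf, -, -, rfl, rfl⟩
  exact pivotTerm_mem_endGrading hf n

theorem pivot_mem_pivotMonomials (n : ℕ) : pivot K n ∈ pivotMonomials K lam (lam ^ n) 1 :=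
  ⟨n, ∅, 1, isMon_one, ⟨by simp, by simp⟩, by simp [letterWeight], by simp,
    (pivotTerm_one n).symm⟩

theorem isSuperGrading_endGrading (K : Type*) [Field K] : IsSuperGrading (endGrading K) where
  mul_mem := by
    intro α β a b ha hb γ x hx
    rw [add_assoc]
    exact ha _ _ (hb _ _ hx)
  disjoint := by
    rw [Submodule.disjoint_def]
    intro φ h0 h1
    have hd := (CliffordAlgebra.evenOdd_isCompl (Q := (0 : QuadraticForm K (ℕ →₀ K))))
    have hz : ∀ β, ∀ x ∈ CliffordAlgebra.evenOdd (0 : QuadraticForm K (ℕ →₀ K)) β, φ x = 0 := by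
      intro β x hx
      have h0' := h0 β x hx
      have h1' := h1 β x hx
      have h01 : ∀ γ : ZMod 2, γ = 0 ∨ γ = 1 := by decide
      rcases h01 β with rfl | rfl
      · exact Submodule.disjoint_def.mp hd.disjoint _ h0' h1'
      · exact Submodule.disjoint_def.mp hd.disjoint _ h1' h0'
    refine LinearMap.ext fun x => ?_
    have hx : x ∈ CliffordAlgebra.evenOdd (0 : QuadraticForm K (ℕ →₀ K)) 0 ⊔
        CliffordAlgebra.evenOdd (0 : QuadraticForm K (ℕ →₀ K)) 1 := by
      rw [hd.sup_eq_top]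
      exact Submodule.mem_top
    obtain ⟨y, hy, z, hz', rfl⟩ := Submodule.mem_sup.mp hx
    rw [map_add, hz 0 y hy, hz 1 z hz', add_zero, LinearMap.zero_apply]

/-- Each homogeneous element of `Q` is a combination of admissible monomials. -/
theorem exists_mem_span_pivotMonomials (hlam : lam ^ 3 = lam + 2) {α : ZMod 2}
    {φ : Module.End K (Grassmann K)} (hφ : φ ∈ Q K) (hα : φ ∈ endGrading K α) :
    ∃ t : ℝ, 0 ≤ t ∧ φ ∈ Submodule.span K (pivotMonomials K lam t α) := by
  set B : ZMod 2 → Set (Module.End K (Grassmann K)) := fun α => ⋃ t, pivotMonomials K lam t α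
    with hB
  have hsub : ∀ t α, Submodule.span K (pivotMonomials K lam t α) ≤ Submodule.span K (B α) :=
    fun t α => Submodule.span_mono (Set.subset_iUnion (fun t => pivotMonomials K lam t α) t)
  have hgr : ∀ α, B α ⊆ endGrading K α := fun α =>
    Set.iUnion_subset fun t => pivotMonomials_subset_endGrading t α
  have hL := (isSuperGrading_endGrading K).isLieSubsuperalgebra_sup hgr
    (fun α β x hx y hy => by
      obtain ⟨s, hs⟩ := Set.mem_iUnion.mp hx
      obtain ⟨t, ht⟩ := Set.mem_iUnion.mp hy
      exact hsub _ _ (superComm_pivotMonomials_mem hlam hs ht))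
    (fun x hx => by
      obtain ⟨s, hs⟩ := Set.mem_iUnion.mp hx
      exact hsub _ _ (pivotMonomials_sq_mem hlam hs))
  have hmem : φ ∈ Submodule.span K (B 0) ⊔ Submodule.span K (B 1) := by
    refine Submodule.mem_sInf.mp hφ _ ⟨?_, hL⟩
    have hp : ∀ n, pivot K n ∈ Submodule.span K (B 0) ⊔ Submodule.span K (B 1) := fun n =>
      Submodule.mem_sup_right (hsub _ _ (Submodule.subset_span (pivot_mem_pivotMonomials n)))
    rintro x (rfl | rfl | rfl)
    exacts [hp 0, hp 1, hp 2]
  have hmem' : φ ∈ Submodule.span K (B α) :=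
    (isSuperGrading_endGrading K).mem_span_of_mem_sup (B := fun α => Submodule.span K (B α))
      (fun α => Submodule.span_le.mpr (hgr α)) hmem hα
  clear hmem hα hφ
  induction hmem' using Submodule.span_induction with
  | mem x h =>
    obtain ⟨t, ht⟩ := Set.mem_iUnion.mp h
    exact ⟨max t 0, le_max_right _ _,
      Submodule.subset_span (pivotMonomials_mono (le_max_left _ _) _ ht)⟩
  | zero => exact ⟨0, le_rfl, Submodule.zero_mem _⟩
  | add x y _ _ ihx ihy =>
    obtain ⟨s, hs, hx⟩ := ihx
    obtain ⟨t, _, hy⟩ := ihy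
    exact ⟨max s t, le_max_of_le_left hs, Submodule.add_mem _
      (Submodule.span_mono (pivotMonomials_mono (le_max_left _ _) _) hx)
      (Submodule.span_mono (pivotMonomials_mono (le_max_right _ _) _) hy)⟩
  | smul c x _ ih =>
    obtain ⟨t, ht, h⟩ := ih
    exact ⟨t, ht, Submodule.smul_mem _ c h⟩

/-- Lie monomials of length `n` in elements of weight at most `t` have weight at most `n t`. -/
theorem isLieMonomial_mem_span (hlam : lam ^ 3 = lam + 2) {X : Set (Module.End K (Grassmann K))}
    {t : ℝ} (hX : ∀ x ∈ X, ∀ α, x ∈ endGrading K α →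
      x ∈ Submodule.span K (pivotMonomials K lam t α)) {n : ℕ} {α : ZMod 2}
    {φ : Module.End K (Grassmann K)} (hφ : IsLieMonomial (endGrading K) X n α φ) :
    φ ∈ Submodule.span K (pivotMonomials K lam (n * t) α) := by
  induction hφ with
  | gen hx hα => simpa using hX _ hx _ hα
  | @bracket m n α β a b _ _ iha ihb =>
    rw [Nat.cast_add, add_mul]
    exact superComm_mem_of_mem_span
      (fun x hx y hy => superComm_pivotMonomials_mem hlam hx hy) iha ihb

theorem growthSpace_le_span (hlam : lam ^ 3 = lam + 2) {X : Set (Module.End K (Grassmann K))}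
    {t : ℝ} (ht : 0 ≤ t) (hX : ∀ x ∈ X, ∀ α, x ∈ endGrading K α →
      x ∈ Submodule.span K (pivotMonomials K lam t α)) (n : ℕ) :
    growthSpace (endGrading K) X n ≤
      Submodule.span K (pivotMonomials K lam (n * t) 0 ∪ pivotMonomials K lam (n * t) 1) := by
  have hle : ∀ α, pivotMonomials K lam (n * t) α ⊆
      pivotMonomials K lam (n * t) 0 ∪ pivotMonomials K lam (n * t) 1 := by
    have h01 : ∀ γ : ZMod 2, γ = 0 ∨ γ = 1 := by decide
    intro α
    rcases h01 α with rfl | rfl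
    · exact Set.subset_union_left
    · exact Set.subset_union_right
  refine Submodule.span_le.mpr ?_
  rintro φ (⟨k, hk, α, hφ⟩ | ⟨k, hk, ψ, hψ, rfl⟩)
  · have hk' : (k : ℝ) * t ≤ n * t := by gcongr
    exact Submodule.span_mono ((pivotMonomials_mono hk' α).trans (hle α))
      (isLieMonomial_mem_span hlam hX hφ)
  · have hk' : (k : ℝ) * t + k * t ≤ n * t := by
      have : (2 * k : ℝ) ≤ n := by exact_mod_cast hk
      nlinarith
    exact Submodule.span_mono ((pivotMonomials_mono hk' 0).trans (hle 0))
      (sq_mem_of_mem_span (fun x hx => pivotMonomials_sq_mem hlam hx)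
        (fun x hx y hy => superComm_pivotMonomials_mem hlam hx hy)
        (isLieMonomial_mem_span hlam hX hψ))

end Upper

/-! ### Dimensions of Grassmann algebras in finitely many letters -/

section Dimension

variable {K : Type*} [Field K] {S T : Finset ℕ} {f g : Grassmann K}

variable (K) in
/-- The Grassmann algebra in the letters `x_a, …, x_{a+k-1}`. -/
def letterSpan (a : ℕ) : ℕ → Submodule K (Grassmann K)
  | 0 => Submodule.span K {1}
  | k + 1 => letterSpan a k ⊔ (letterSpan a k).map (LinearMap.mulLeft K (letter K (a + k)))

theorem partialD_eq_zero_of_mem_letterSpan {a k n : ℕ} (hn : a + k ≤ n)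
    (hf : f ∈ letterSpan K a k) : partialD K n f = 0 := by
  induction k generalizing f with
  | zero =>
    obtain ⟨c, rfl⟩ := Submodule.mem_span_singleton.mp hf
    rw [map_smul, isMon_one.partialD_eq_zero (Finset.notMem_empty n), smul_zero]
  | succ k ih =>
    obtain ⟨x, hx, _, ⟨y, hy, rfl⟩, rfl⟩ := Submodule.mem_sup.mp hf
    rw [map_add, ih (by omega) hx, LinearMap.mulLeft_apply, partialD_letter_mul_of_ne (by omega),
      ih (by omega) hy, mul_zero, neg_zero, add_zero]

/-- Each new letter doubles the dimension: applying `∂_{a+k}` to `x + x_{a+k} y` recovers `y`, and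
then `x`. -/
theorem letterSpan_finrank (K : Type*) [Field K] (a k : ℕ) :
    FiniteDimensional K (letterSpan K a k) ∧ Module.finrank K (letterSpan K a k) = 2 ^ k := by
  induction k with
  | zero =>
    refine ⟨?_, ?_⟩
    · rw [letterSpan]
      infer_instance
    · rw [letterSpan, finrank_span_singleton one_ne_zero, pow_zero]
  | succ k ih =>
    obtain ⟨hfin, hrank⟩ := ih
    set V := letterSpan K a k with hV
    set φ : V × V →ₗ[K] Grassmann K :=
      V.subtype.coprod (LinearMap.mulLeft K (letter K (a + k)) ∘ₗ V.subtype) with hφ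
    have hrange : letterSpan K a (k + 1) = LinearMap.range φ := by
      rw [hφ, LinearMap.range_coprod, LinearMap.range_comp, Submodule.range_subtype]
      rfl
    have hinj : Function.Injective φ := by
      rw [injective_iff_map_eq_zero]
      rintro ⟨⟨x, hx⟩, ⟨y, hy⟩⟩ h
      have h : x + letter K (a + k) * y = 0 := by simpa [hφ] using h
      have h1 := congrArg (partialD K (a + k)) h
      rw [map_add, partialD_letter_mul_self, partialD_eq_zero_of_mem_letterSpan le_rfl hx,
        partialD_eq_zero_of_mem_letterSpan le_rfl hy, map_zero, mul_zero, sub_zero, zero_add] at h1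
      subst h1
      rw [mul_zero, add_zero] at h
      subst h
      rfl
    rw [hrange]
    refine ⟨inferInstance, ?_⟩
    rw [LinearMap.finrank_range_of_inj hinj, Module.finrank_prod, hrank, pow_succ, mul_two]

theorem letter_mul_mem_letterSpan {a k i : ℕ} (hi : a ≤ i) (hi' : i < a + k)
    (hf : f ∈ letterSpan K a k) : letter K i * f ∈ letterSpan K a k := by
  induction k generalizing f with
  | zero => omega
  | succ k ih =>
    obtain ⟨x, hx, _, ⟨y, hy, rfl⟩, rfl⟩ := Submodule.mem_sup.mp hf
    rw [LinearMap.mulLeft_apply, mul_add]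
    rcases eq_or_ne i (a + k) with rfl | h
    · rw [letter_mul_self_mul, add_zero]
      exact Submodule.mem_sup_right ⟨x, hx, rfl⟩
    · rw [letter_mul_left_comm]
      exact Submodule.add_mem _ (Submodule.mem_sup_left (ih (by omega) hx))
        (Submodule.neg_mem _ (Submodule.mem_sup_right ⟨_, ih (by omega) hy, rfl⟩))

theorem one_mem_letterSpan (a k : ℕ) : (1 : Grassmann K) ∈ letterSpan K a k := by
  induction k with
  | zero => exact Submodule.mem_span_singleton_self 1
  | succ k ih => exact Submodule.mem_sup_left ih

theorem IsMon.mem_letterSpan (hf : IsMon S f) {a k : ℕ} (hS : S ⊆ Finset.Ico a (a + k)) :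
    f ∈ letterSpan K a k := by
  induction hf with
  | scalar c =>
    rw [Algebra.algebraMap_eq_smul_one]
    exact Submodule.smul_mem _ _ (one_mem_letterSpan a k)
  | letter_mul i hi _ ih =>
    rw [Finset.insert_subset_iff, Finset.mem_Ico] at hS
    exact letter_mul_mem_letterSpan hS.1.1 hS.1.2 (ih hS.2)

theorem letterSpan_le_span (a k : ℕ) :
    letterSpan K a k ≤ Submodule.span K {f | ∃ S ⊆ Finset.Ico a (a + k), IsMon S f} := by
  induction k with
  | zero =>
    refine Submodule.span_mono ?_
    rintro _ rfl
    exact ⟨∅, by simp, isMon_one⟩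
  | succ k ih =>
    refine sup_le (ih.trans (Submodule.span_mono ?_)) ?_
    · rintro f ⟨S, hS, hf⟩
      exact ⟨S, hS.trans (Finset.Ico_subset_Ico_right (by omega)), hf⟩
    · refine (Submodule.map_mono ih).trans ?_
      rw [Submodule.map_span_le]
      rintro f ⟨S, hS, hf⟩
      refine Submodule.subset_span ⟨insert (a + k) S, ?_, .letter_mul (a + k) (fun h => ?_) hf⟩
      · rw [Finset.insert_subset_iff]
        exact ⟨by simp, hS.trans (Finset.Ico_subset_Ico_right (by omega))⟩
      · have := Finset.mem_Ico.mp (hS h)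
        omega

/-- The coefficient is recovered by evaluating at `x_n`, since `v_n(x_n) = 1`. -/
theorem pivotTerm_injective (n : ℕ) : Function.Injective (pivotTerm (K := K) n) := by
  rw [injective_iff_map_eq_zero]
  intro f hf
  have h := LinearMap.congr_fun hf (letter K n)
  rwa [pivotTerm_apply, pivot_letter, mul_one] at h

variable (K) in
/-- The superderivations `f v_m`, where `m < M` and `f` involves only letters `x_j` with `j < m`. -/
def pivotSpan : ℕ → Submodule K (Module.End K (Grassmann K))
  | 0 => ⊥
  | M + 1 => pivotSpan M ⊔ (letterSpan K 0 M).map (pivotTerm M)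

/-- Heads below `M` contribute at most `1 + 2 + ⋯ + 2^{M-1} < 2^M`. -/
theorem pivotSpan_finrank (K : Type*) [Field K] (M : ℕ) :
    FiniteDimensional K (pivotSpan K M) ∧ Module.finrank K (pivotSpan K M) ≤ 2 ^ M := by
  induction M with
  | zero =>
    rw [pivotSpan]
    exact ⟨inferInstance, by simp⟩
  | succ M ih =>
    obtain ⟨hfin, hrank⟩ := ih
    obtain ⟨hfin', hrank'⟩ := letterSpan_finrank K 0 M
    rw [pivotSpan]
    refine ⟨inferInstance, (Submodule.finrank_add_le_finrank_add_finrank _ _).trans ?_⟩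
    have := Submodule.finrank_map_le (pivotTerm M) (letterSpan K 0 M)
    rw [pow_succ, mul_two]
    omega

theorem pivotTerm_mem_pivotSpan {m M : ℕ} (h : m < M) (hf : f ∈ letterSpan K 0 m) :
    pivotTerm m f ∈ pivotSpan K M := by
  induction M with
  | zero => omega
  | succ M ih =>
    rcases eq_or_ne m M with rfl | hne
    · exact Submodule.mem_sup_right ⟨f, hf, rfl⟩
    · exact Submodule.mem_sup_left (ih (by omega))

end Dimension

/-! ### Bounds for the growth -/

section Growth

variable {K : Type*} [Field K] {S T : Finset ℕ} {f g : Grassmann K} {lam : ℝ}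

theorem letterWeight_le (hlam : 1 < lam) {p : ℕ} (hS : S ⊆ Finset.range p) :
    (lam - 1) * letterWeight lam S ≤ lam ^ p := by
  have h1 : letterWeight lam S ≤ ∑ j ∈ Finset.range p, lam ^ j :=
    Finset.sum_le_sum_of_subset_of_nonneg hS fun _ _ _ => by positivity
  have h2 := mul_geom_sum lam p
  nlinarith

/-- In the heaviest case `x_{n-2}` occurs, `x_{n-3}` does not, and everything from `x_{n-4}` down
does; a geometric sum bounds this by about `0.977 λ^n`. Allowing both top letters would let the
geometric bound exceed `λ^n`. -/
theorem Admissible.le_weight (hlam : lam ^ 3 = lam + 2) (h₁ : 1.5213 < lam) (h₂ : lam < 1.5214)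
    {n : ℕ} (hS : Admissible n S) : lam ^ n / 50 ≤ lam ^ n - letterWeight lam S := by
  have hpos : ∀ k : ℕ, 0 < lam ^ k := fun k => by positivity
  have hsq : 2.314 < lam ^ 2 := by nlinarith
  suffices h : letterWeight lam S ≤ 49 / 50 * lam ^ n by linarith
  rcases Nat.lt_or_ge n 2 with hn | hn
  · have : S = ∅ := Finset.eq_empty_of_forall_notMem fun j hj => by
      have := hS.1 j hj
      omega
    rw [this, letterWeight, Finset.sum_empty]
    linarith [hpos n]
  obtain ⟨p, rfl⟩ := Nat.exists_eq_add_of_le' hn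
  by_cases hp : p ∈ S
  · rw [← sub_add_cancel (letterWeight lam S) (lam ^ p), ← letterWeight_erase hp]
    rcases p with _ | q
    · have : S.erase 0 = ∅ := Finset.eq_empty_of_forall_notMem fun j hj => by
        have := hS.1 j (Finset.mem_of_mem_erase hj)
        have := Finset.ne_of_mem_erase hj
        omega
      rw [this, letterWeight, Finset.sum_empty, pow_zero, zero_add, zero_add]
      linarith
    · have hsub : S.erase (q + 1) ⊆ Finset.range q := fun j hj => by
        have h1 := Finset.mem_of_mem_erase hj
        have h2 := Finset.ne_of_mem_erase hj
        have h3 := hS.1 j h1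
        have h4 := hS.2 j h1
        have h5 : j ≠ q := by
          rintro rfl
          exact h4 rfl hp
        rw [Finset.mem_range]
        omega
      have h := letterWeight_le (by linarith) hsub
      -- With `n = q + 3`, this compares `λ^q / (λ - 1) + λ^{q+1}` with `49/50 · λ^{q+3}`, after
      -- clearing `λ - 1`; it is the tight case for the constant 50.
      have hk : 1 + (lam - 1) * lam ≤ (lam - 1) * (49 / 50 * lam ^ 3) := by
        rw [hlam]
        nlinarith
      have hm := mul_le_mul_of_nonneg_left hk (hpos q).le
      refine le_of_mul_le_mul_left ?_ (show 0 < lam - 1 by linarith)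
      calc (lam - 1) * (letterWeight lam (S.erase (q + 1)) + lam ^ (q + 1))
          ≤ lam ^ q * (1 + (lam - 1) * lam) := by
            rw [mul_add, pow_succ]
            linarith
        _ ≤ lam ^ q * ((lam - 1) * (49 / 50 * lam ^ 3)) := hm
        _ = (lam - 1) * (49 / 50 * lam ^ (q + 1 + 2)) := by ring
  · have hsub : S ⊆ Finset.range p := fun j hj => by
      have := hS.1 j hj
      have : j ≠ p := by
        rintro rfl
        exact hp hj
      rw [Finset.mem_range]
      omega
    have h := letterWeight_le (by linarith) hsub
    have hk : 1 ≤ (lam - 1) * (49 / 50 * lam ^ 2) := by nlinarith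
    have hm := mul_le_mul_of_nonneg_left hk (hpos p).le
    refine le_of_mul_le_mul_left ?_ (show 0 < lam - 1 by linarith)
    calc (lam - 1) * letterWeight lam S ≤ lam ^ p * 1 := by linarith
      _ ≤ lam ^ p * ((lam - 1) * (49 / 50 * lam ^ 2)) := hm
      _ = (lam - 1) * (49 / 50 * lam ^ (p + 2)) := by ring

theorem pivotMonomials_subset_pivotSpan (hlam : lam ^ 3 = lam + 2) (h₁ : 1.5213 < lam)
    (h₂ : lam < 1.5214) {t : ℝ} {M : ℕ} (hM : 50 * t < lam ^ M) (α : ZMod 2) :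
    pivotMonomials K lam t α ⊆ pivotSpan K M := by
  rintro _ ⟨m, S, f, hf, hS, hw, -, rfl⟩
  have hlt : lam ^ m < lam ^ M := by
    have := hS.le_weight hlam h₁ h₂
    linarith
  refine pivotTerm_mem_pivotSpan ((pow_lt_pow_iff_right₀ (by linarith)).mp hlt)
    (hf.mem_letterSpan fun j hj => ?_)
  have := hS.1 j hj
  rw [Finset.mem_Ico]
  omega

theorem growthSpace_le_pivotSpan (hlam : lam ^ 3 = lam + 2) (h₁ : 1.5213 < lam)
    (h₂ : lam < 1.5214) {X : Set (Module.End K (Grassmann K))}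
    {t : ℝ} (ht : 0 ≤ t) (hX : ∀ x ∈ X, ∀ α, x ∈ endGrading K α →
      x ∈ Submodule.span K (pivotMonomials K lam t α)) {n M : ℕ} (hM : 50 * (n * t) < lam ^ M) :
    growthSpace (endGrading K) X n ≤ pivotSpan K M :=
  (growthSpace_le_span hlam ht hX n).trans <| Submodule.span_le.mpr <| Set.union_subset
    (pivotMonomials_subset_pivotSpan hlam h₁ h₂ hM 0)
    (pivotMonomials_subset_pivotSpan hlam h₁ h₂ hM 1)

/-- Without `x_j` in `f`, only the tail of `v_j` acts, and it starts with `x_j`. -/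
theorem IsMon.letter_mul_pivot (hf : IsMon S f) {j : ℕ} (hj : j ∉ S) :
    letter K j * pivot K j f = 0 := by
  rw [pivot_step, hf.partialD_eq_zero hj, zero_add, letter_mul_self_mul]

/-- Bracketing with `v_j` removes the letter `x_j`. -/
theorem superComm_pivot_letter_mul (hf : IsMon S f) {j n : ℕ} (hj : j ∉ S) (hjn : j < n) :
    superComm 1 ((S.card + 1 + 1 : ℕ) : ZMod 2) (pivot K j) (pivotTerm n (letter K j * f))
      = pivotTerm n f := by
  have hcard : (insert j S).card = S.card + 1 := Finset.card_insert_of_notMem hj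
  refine LinearMap.ext fun x => ?_
  have h := superComm_pivotTerm_apply isMon_one (.letter_mul j hj hf) (n := j) (m := n)
    (by simp) x
  rw [Finset.card_empty, zero_add, Nat.cast_one, hcard, pivotTerm_one] at h
  -- The anticommutator of `v_j` and `v_n` starts with `x_j`, so the coefficient `x_j f` annihilates
  -- it.
  have h2 : letter K j * f * pivotComm K j n x = 0 := by
    have h3 := hf.letter_comm j
    have h4 : letter K j * f = (-1 : K) ^ S.card • (f * letter K j) := by
      rw [h3, smul_smul, ← pow_add, ← two_mul, pow_mul, neg_one_sq, one_pow, one_smul]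
    rw [h4, smul_mul_assoc, mul_assoc, letter_mul_pivotComm hjn, mul_zero, smul_zero]
  rw [h, one_mul, one_mul, h2, smul_zero, add_zero, pivot_letter_mul_self,
    hf.letter_mul_pivot hj, sub_zero, pivotTerm_apply]

theorem superComm_pivot_succ (n : ℕ) :
    superComm 1 1 (pivot K n) (pivot K (n + 1)) = -pivotTerm (n + 3) (letter K n) := by
  refine LinearMap.ext fun x => ?_
  rw [superComm_one_one, LinearMap.neg_apply, pivotTerm_apply, ← pivotComm_succ]
  rfl

/-- One bracket raises the head by three and fills in three consecutive letters, which is what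
builds the long monomials of the lower bound. -/
theorem superComm_pivot_add_two (hf : IsMon S f) {n : ℕ} (hS : ∀ j ∈ S, j < n) :
    superComm 1 ((S.card + 1 : ℕ) : ZMod 2) (pivot K n) (pivotTerm (n + 2) f)
      = -pivotTerm (n + 5) (letter K n * (letter K (n + 1) * (letter K (n + 2) * f))) := by
  refine LinearMap.ext fun x => ?_
  have h := superComm_pivotTerm_apply isMon_one hf (n := n) (m := n + 2) (by simp) x
  rw [Finset.card_empty, zero_add, Nat.cast_one, pivotTerm_one, hf.pivot_eq_zero hS,
    pivotComm_add_two] at h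
  have h2 : f * (letter K n * (letter K (n + 1) * letter K (n + 2)))
      = (-1 : K) ^ S.card • (letter K n * (letter K (n + 1) * letter K (n + 2)) * f) := by
    have h3 := (IsMon.letter_mul n (by simp [add_assoc]) (isMon_pair (K := K) (n + 1))).mul_comm hf
    have h4 : (-1 : K) ^ 3 = -1 := by norm_num
    rw [h3, Finset.card_insert_of_notMem (by simp [add_assoc]), Finset.card_pair (by omega),
      pow_mul, h4]
  rw [h, LinearMap.neg_apply, pivotTerm_apply, mul_zero, zero_mul, zero_add, one_mul, mul_neg,
    smul_neg, ← mul_assoc (letter K (n + 1)), ← mul_assoc (letter K n), ← mul_assoc f, h2,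
    smul_mul_assoc, smul_smul, ← pow_add, ← two_mul, pow_mul, neg_one_sq, one_pow, one_smul]
  simp only [mul_assoc]

/-- Since `v_{m+3} = -[v_m, [v_m, v_{m+1}]]`, the length budgets satisfy exactly the recursion of
the weights. Squares are not needed, so characteristic 2 is no exception. -/
theorem pivot_mem_lieSpan (hlam : lam ^ 3 = lam + 2) (h₁ : 1 < lam)
    {X : Set (Module.End K (Grassmann K))} {N : ℝ} (hN : 0 ≤ N)
    (hX : ∀ n < 3, pivot K n ∈ lieSpan (endGrading K) X N 1) (n : ℕ) :
    pivot K n ∈ lieSpan (endGrading K) X (N * lam ^ n) 1 := by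
  induction n using Nat.strong_induction_on with
  | _ n ih =>
    rcases Nat.lt_or_ge n 3 with hn | hn
    · exact lieSpan_mono (le_mul_of_one_le_right hN (one_le_pow₀ h₁.le)) _ (hX n hn)
    · obtain ⟨m, rfl⟩ := Nat.exists_eq_add_of_le' hn
      have h0 := ih m (by omega)
      have h2 := superComm_mem_lieSpan h0 (superComm_mem_lieSpan h0 (ih (m + 1) (by omega)))
      have h3 := superComm_pivot_letter_mul (K := K) isMon_one (j := m) (n := m + 3)
        (Finset.notMem_empty m) (by omega)
      rw [Finset.card_empty, mul_one, pivotTerm_one] at h3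
      have h4 : superComm 1 (1 + 1) (pivot K m) (superComm 1 1 (pivot K m) (pivot K (m + 1)))
          = -pivot K (m + 3) := by
        rw [superComm_pivot_succ, superComm_neg_right, ← h3]
        rfl
      rw [h4, Submodule.neg_mem_iff, show (1 : ZMod 2) + (1 + 1) = 1 from rfl] at h2
      rw [weight_rec hlam]
      convert h2 using 2
      ring

/-- The monomial superderivations `x_2 x_3 ⋯ x_{n-3} v_n`, for `n = 3 k + 4`. -/
theorem pivotTerm_Ico_mem_lieSpan (hlam : lam ^ 3 = lam + 2) (h₁ : 1 < lam)
    {X : Set (Module.End K (Grassmann K))} {N : ℝ} (hN : 0 ≤ N)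
    (hX : ∀ n < 3, pivot K n ∈ lieSpan (endGrading K) X N 1) (k : ℕ) :
    ∀ f : Grassmann K, IsMon (Finset.Ico 2 (2 + 3 * k)) f →
      pivotTerm (3 * k + 4) f ∈
        lieSpan (endGrading K) X (N * lam ^ (3 * k + 4)) ((3 * k + 1 : ℕ) : ZMod 2) := by
  induction k with
  | zero =>
    intro f hf
    rw [mul_zero, add_zero, Finset.Ico_self] at hf
    have hc : ∃ c : K, f = c • 1 := by
      have := hf.mem_letterSpan (a := 0) (k := 0) (by simp)
      obtain ⟨c, rfl⟩ := Submodule.mem_span_singleton.mp this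
      exact ⟨c, rfl⟩
    obtain ⟨c, rfl⟩ := hc
    rw [map_smul, pivotTerm_one]
    exact Submodule.smul_mem _ c (by simpa using pivot_mem_lieSpan hlam h₁ hN hX 4)
  | succ k ih =>
    intro f hf
    set n := 2 + 3 * k with hn
    have hmem : ∀ i, i < 3 → n + i ∈ Finset.Ico 2 (2 + 3 * (k + 1)) := fun i hi => by
      rw [Finset.mem_Ico]
      omega
    -- Three letters `x_n, x_{n+1}, x_{n+2}` are peeled off; bracketing `v_n` with `g v_{n+2}`
    -- restores them in front of `v_{n+5}`.
    obtain ⟨g₁, hg₁, rfl⟩ := hf.exists_letter_mul (hmem 0 (by omega))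
    obtain ⟨g₂, hg₂, rfl⟩ := hg₁.exists_letter_mul (i := n + 1)
      (Finset.mem_erase.mpr ⟨by omega, hmem 1 (by omega)⟩)
    obtain ⟨g, hg, rfl⟩ := hg₂.exists_letter_mul (i := n + 2)
      (Finset.mem_erase.mpr ⟨by omega, Finset.mem_erase.mpr ⟨by omega, hmem 2 (by omega)⟩⟩)
    have hS : (((Finset.Ico 2 (2 + 3 * (k + 1))).erase (n + 0)).erase (n + 1)).erase (n + 2)
        = Finset.Ico 2 n := by
      ext j
      simp only [Finset.mem_erase, Finset.mem_Ico]
      omega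
    rw [hS] at hg
    have hcard : (Finset.Ico 2 n).card = 3 * k := by
      rw [Nat.card_Ico]
      omega
    have h := superComm_mem_lieSpan (pivot_mem_lieSpan hlam h₁ hN hX n) (ih g hg)
    have h2 := superComm_pivot_add_two hg (n := n) (fun j hj => (Finset.mem_Ico.mp hj).2)
    rw [hcard] at h2
    rw [show 3 * k + 4 = n + 2 by omega, h2, Submodule.neg_mem_iff] at h
    rw [show 3 * (k + 1) + 4 = n + 5 by omega, add_zero]
    have hpar : (1 : ZMod 2) + ((3 * k + 1 : ℕ) : ZMod 2) = ((3 * (k + 1) + 1 : ℕ) : ZMod 2) := by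
      push_cast
      have : ∀ a : ZMod 2, 1 + (3 * a + 1) = 3 * (a + 1) + 1 := by decide
      exact this k
    rw [hpar] at h
    refine lieSpan_mono ?_ _ h
    rw [← mul_add]
    refine mul_le_mul_of_nonneg_left ?_ hN
    rw [show n + 5 = n + 2 + 3 by ring, weight_rec hlam, show n + 2 + 1 = n + 3 by ring,
      weight_rec hlam]
    have h5 : 0 < lam ^ n := by positivity
    have h6 : 0 < lam ^ (n + 1) := by positivity
    have h7 : 0 < lam ^ (n + 2) := by positivity
    linarith

/-- Starting from the full product, the letters of `R` are deleted one at a time by brackets with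
`v_j`, each adding `N λ^j` to the length. -/
theorem pivotTerm_sdiff_mem_lieSpan (hlam : lam ^ 3 = lam + 2) (h₁ : 1 < lam)
    {X : Set (Module.End K (Grassmann K))} {N : ℝ} (hN : 0 ≤ N)
    (hX : ∀ n < 3, pivot K n ∈ lieSpan (endGrading K) X N 1) (k : ℕ) (R : Finset ℕ) :
    R ⊆ Finset.Ico 2 (2 + 3 * k) → ∀ f : Grassmann K, IsMon (Finset.Ico 2 (2 + 3 * k) \ R) f →
      pivotTerm (3 * k + 4) f ∈
        lieSpan (endGrading K) X (N * lam ^ (3 * k + 4) + N * letterWeight lam R)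
          (((Finset.Ico 2 (2 + 3 * k) \ R).card + 1 : ℕ) : ZMod 2) := by
  induction R using Finset.induction_on with
  | empty =>
    intro _ f hf
    rw [Finset.sdiff_empty] at hf ⊢
    have := pivotTerm_Ico_mem_lieSpan hlam h₁ hN hX k f hf
    simpa [letterWeight] using this
  | insert j R hj ih =>
    intro hR f hf
    rw [Finset.insert_subset_iff, Finset.mem_Ico] at hR
    set I := Finset.Ico 2 (2 + 3 * k) with hI
    have hjS : j ∉ I \ insert j R := by simp
    have hins : insert j (I \ insert j R) = I \ R := by
      rw [Finset.sdiff_insert, Finset.insert_erase]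
      rw [Finset.mem_sdiff, hI, Finset.mem_Ico]
      exact ⟨hR.1, hj⟩
    have h1 := ih hR.2 (letter K j * f) (hins ▸ .letter_mul j hjS hf)
    have h2 := superComm_mem_lieSpan (pivot_mem_lieSpan hlam h₁ hN hX j) h1
    rw [← hins, Finset.card_insert_of_notMem hjS,
      superComm_pivot_letter_mul hf hjS (by omega)] at h2
    have hpar : ∀ a : ℕ, (1 : ZMod 2) + ((a + 1 + 1 : ℕ) : ZMod 2) = ((a + 1 : ℕ) : ZMod 2) := by
      intro a
      push_cast
      have : ∀ a : ZMod 2, 1 + (a + 1 + 1) = a + 1 := by decide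
      exact this a
    rw [hpar] at h2
    refine lieSpan_mono (le_of_eq ?_) _ h2
    rw [letterWeight, letterWeight, Finset.sum_insert hj]
    ring

theorem map_letterSpan_le_growthSpace (hlam : lam ^ 3 = lam + 2) (h₁ : 1.5213 < lam)
    (h₂ : lam < 1.5214) {X : Set (Module.End K (Grassmann K))} {N : ℝ} (hN : 0 ≤ N)
    (hX : ∀ n < 3, pivot K n ∈ lieSpan (endGrading K) X N 1) {k n : ℕ}
    (hn : 2 * N * lam ^ (3 * k + 4) ≤ n) :
    (letterSpan K 2 (3 * k)).map (pivotTerm (3 * k + 4)) ≤ growthSpace (endGrading K) X n := by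
  refine (Submodule.map_mono (letterSpan_le_span 2 (3 * k))).trans ?_
  rw [Submodule.map_span_le]
  rintro f ⟨S, hS, hf⟩
  set I := Finset.Ico 2 (2 + 3 * k) with hI
  have h := pivotTerm_sdiff_mem_lieSpan hlam (by linarith) hN hX k (I \ S) Finset.sdiff_subset f
    (by rwa [← hI, Finset.sdiff_sdiff_eq_self hS])
  refine lieSpan_le_growthSpace (le_trans ?_ hn) _ h
  -- Deleting any set of letters costs at most as much as building the full monomial, whence the
  -- factor 2 in the length bound.
  have hle : letterWeight lam (I \ S) ≤ lam ^ (3 * k + 4) := by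
    have h3 := letterWeight_le (lam := lam) (by linarith) (S := I \ S) (p := 3 * k + 2) (by
      intro j hj
      have := Finset.mem_Ico.mp (Finset.sdiff_subset hj)
      rw [Finset.mem_range]
      omega)
    refine le_of_mul_le_mul_left (h3.trans ?_) (show 0 < lam - 1 by linarith)
    have hk : 1 ≤ (lam - 1) * lam ^ 2 := by nlinarith
    have hpos : 0 < lam ^ (3 * k + 2) := by positivity
    calc lam ^ (3 * k + 2) ≤ lam ^ (3 * k + 2) * ((lam - 1) * lam ^ 2) :=
          le_mul_of_one_le_right hpos.le hk
      _ = (lam - 1) * lam ^ (3 * k + 4) := by ring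
  have := mul_le_mul_of_nonneg_left hle hN
  linarith

end Growth

/-! ### The root of `t³ - t - 2` and the growth exponent -/

section Exponent

/-- The bracket is narrower than the required accuracy for `λ`, because an error of `10^{-4}` in `λ`
would be too coarse for `log_λ 2`. -/
theorem exists_root_cubic : ∃ lam : ℝ, lam ^ 3 = lam + 2 ∧ 1.52137 < lam ∧ lam < 1.52138 := by
  have hc : ContinuousOn (fun t : ℝ => t ^ 3 - t - 2) (Set.Icc 1.52137 1.52138) := by fun_prop
  have h := intermediate_value_Ioo (by norm_num) hc
  obtain ⟨lam, hlam, h0⟩ := h (show (0 : ℝ) ∈ _ by constructor <;> norm_num)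
  exact ⟨lam, by linarith [show lam ^ 3 - lam - 2 = 0 from h0], hlam.1, hlam.2⟩

theorem cubic_eq_zero_iff {lam : ℝ} (hlam : lam ^ 3 = lam + 2) (h₁ : 1.5213 < lam) (t : ℝ) :
    t ^ 3 - t - 2 = 0 ↔ t = lam := by
  refine ⟨fun h => ?_, fun h => by rw [h]; linarith⟩
  have h2 : (t - lam) * (t ^ 2 + t * lam + lam ^ 2 - 1) = 0 := by linear_combination h - hlam
  rcases mul_eq_zero.mp h2 with h3 | h3
  · linarith
  -- The cofactor is `(t + λ/2)² + 3λ²/4 - 1`, which is positive.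
  · nlinarith [sq_nonneg (t + lam / 2)]

set_option exponentiation.threshold 300 in
-- Both fractions lie within `10^{-4}` of `1.6518`; clearing denominators reduces the bounds to
-- `λ^185 < 2^112` and `2^158 < λ^261`.
theorem logb_two_bounds {lam : ℝ} (h₁ : 1.52137 < lam) (h₂ : lam < 1.52138) :
    (185 / 112 : ℝ) < Real.logb lam 2 ∧ Real.logb lam 2 < 261 / 158 := by
  have hl : 0 < Real.log lam := Real.log_pos (by linarith)
  rw [Real.logb, lt_div_iff₀ hl, div_lt_iff₀ hl]
  have e1 : (lam : ℝ) ^ 185 < 2 ^ 112 :=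
    (pow_lt_pow_left₀ h₂ (by linarith) (by norm_num)).trans (by norm_num)
  have e2 : (2 : ℝ) ^ 158 < lam ^ 261 :=
    lt_trans (by norm_num) (pow_lt_pow_left₀ h₁ (by norm_num) (by norm_num))
  have l1 := Real.log_lt_log (by positivity) e1
  have l2 := Real.log_lt_log (by positivity) e2
  rw [Real.log_pow, Real.log_pow] at l1 l2
  push_cast at l1 l2
  constructor <;> linarith

theorem tendsto_log_div_log {u : ℕ → ℕ} {d c C : ℝ} (hc : 0 < c) (hC : 0 < C)
    (hlow : ∀ᶠ n : ℕ in Filter.atTop, c * (n : ℝ) ^ d ≤ u n)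
    (hup : ∀ᶠ n : ℕ in Filter.atTop, (u n : ℝ) ≤ C * (n : ℝ) ^ d) :
    Filter.Tendsto (fun n : ℕ => Real.log (u n) / Real.log n) Filter.atTop (nhds d) := by
  have hlog : Filter.Tendsto (fun n : ℕ => Real.log n) Filter.atTop Filter.atTop :=
    Real.tendsto_log_atTop.comp tendsto_natCast_atTop_atTop
  have hlim : ∀ a : ℝ, Filter.Tendsto (fun n : ℕ => Real.log a / Real.log n + d)
      Filter.atTop (nhds d) := fun a => by
    simpa using (hlog.const_div_atTop (Real.log a)).add_const d
  refine tendsto_of_tendsto_of_tendsto_of_le_of_le' (hlim c) (hlim C) ?_ ?_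
  · filter_upwards [hlow, Filter.eventually_ge_atTop 2] with n hn h2
    have hn0 : (0 : ℝ) < n := by positivity
    have hl : 0 < Real.log n := Real.log_pos (by exact_mod_cast h2)
    have h := Real.log_le_log (by positivity) hn
    rw [Real.log_mul hc.ne' (by positivity), Real.log_rpow hn0] at h
    rw [div_add' _ _ _ hl.ne']
    gcongr
  -- The lower bound is needed here too: it makes `u n` positive before taking logarithms.
  · filter_upwards [hlow, hup, Filter.eventually_ge_atTop 2] with n hn' hn h2
    have hn0 : (0 : ℝ) < n := by positivity
    have hl : 0 < Real.log n := Real.log_pos (by exact_mod_cast h2)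
    have h := Real.log_le_log (lt_of_lt_of_le (by positivity) hn') hn
    rw [Real.log_mul hC.ne' (by positivity), Real.log_rpow hn0] at h
    rw [div_add' _ _ _ hl.ne']
    gcongr

theorem pow_rpow_logb_two {lam : ℝ} (h₁ : 1 < lam) (k : ℕ) :
    (lam ^ k) ^ Real.logb lam 2 = (2 : ℝ) ^ k := by
  have h0 : (0 : ℝ) < lam := by linarith
  rw [← Real.rpow_natCast lam, ← Real.rpow_mul h0.le, mul_comm, Real.rpow_mul h0.le,
    Real.rpow_logb h0 h₁.ne' two_pos, Real.rpow_natCast]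

end Exponent

/-! ### Matching power bounds for an arbitrary generating set -/

section Dimensions

variable {K : Type*} [Field K] {lam : ℝ} {X : Set (Module.End K (Grassmann K))}

theorem tendsto_growth (hlam : lam ^ 3 = lam + 2) (h₁ : 1.5213 < lam) (h₂ : lam < 1.5214)
    (hfin : X.Finite) (hhom : ∀ x ∈ X, ∃ α : ZMod 2, x ∈ endGrading K α)
    (hgen : lieSuper (endGrading K) X = Q K) :
    Filter.Tendsto (fun n : ℕ => Real.log (growth (endGrading K) X n) / Real.log n)
      Filter.atTop (nhds (Real.logb lam 2)) := by
  have h1 : 1 < lam := by linarith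
  have hd : 0 < Real.logb lam 2 := Real.logb_pos h1 one_lt_two
  obtain ⟨t, ht, hX⟩ : ∃ t : ℝ, 0 ≤ t ∧ ∀ x ∈ X, ∀ α, x ∈ endGrading K α →
      x ∈ Submodule.span K (pivotMonomials K lam t α) := by
    have hQ : ∀ x ∈ X, x ∈ Q K := fun x hx => by
      rw [← hgen]
      exact Submodule.mem_sInf.mpr fun L hL => hL.1 hx
    have hex : ∀ (x : Module.End K (Grassmann K)) (α : ZMod 2), ∃ t : ℝ, 0 ≤ t ∧
        (x ∈ X → x ∈ endGrading K α → x ∈ Submodule.span K (pivotMonomials K lam t α)) := by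
      intro x α
      by_cases h : x ∈ X ∧ x ∈ endGrading K α
      · obtain ⟨t, ht, hx⟩ := exists_mem_span_pivotMonomials hlam (hQ x h.1) h.2
        exact ⟨t, ht, fun _ _ => hx⟩
      · exact ⟨0, le_rfl, fun hx hα => absurd ⟨hx, hα⟩ h⟩
    choose τ hτ hmem using hex
    -- The sum serves as a common upper bound for finitely many nonnegative weights. Both parities
    -- are included because zero is homogeneous of each.
    refine ⟨∑ x ∈ hfin.toFinset, ∑ α : ZMod 2, τ x α,
      Finset.sum_nonneg fun x _ => Finset.sum_nonneg fun α _ => hτ x α, fun x hx α hα => ?_⟩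
    refine Submodule.span_mono (pivotMonomials_mono ?_ α) (hmem x α hx hα)
    calc τ x α ≤ ∑ α : ZMod 2, τ x α :=
          Finset.single_le_sum (fun α _ => hτ x α) (Finset.mem_univ α)
      _ ≤ _ := Finset.single_le_sum (f := fun x => ∑ α : ZMod 2, τ x α)
          (fun x _ => Finset.sum_nonneg fun α _ => hτ x α) (hfin.mem_toFinset.mpr hx)
  obtain ⟨N, hN, hpiv⟩ : ∃ N : ℝ, 1 ≤ N ∧
      ∀ n < 3, pivot K n ∈ lieSpan (endGrading K) X N 1 := by
    have hex : ∀ n < 3, ∃ N : ℕ, pivot K n ∈ lieSpan (endGrading K) X N 1 := by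
      intro n hn
      refine (isSuperGrading_endGrading K).exists_mem_lieSpan hhom ?_ (pivot_odd K n)
      rw [hgen]
      refine Submodule.mem_sInf.mpr fun L hL => hL.1 ?_
      interval_cases n <;> simp [pivotGens]
    obtain ⟨N₀, h0⟩ := hex 0 (by omega)
    obtain ⟨N₁, h1⟩ := hex 1 (by omega)
    obtain ⟨N₂, h2⟩ := hex 2 (by omega)
    have p0 : (0 : ℝ) ≤ N₀ := N₀.cast_nonneg
    have p1 : (0 : ℝ) ≤ N₁ := N₁.cast_nonneg
    have p2 : (0 : ℝ) ≤ N₂ := N₂.cast_nonneg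
    refine ⟨N₀ + N₁ + N₂ + 1, by linarith, fun n hn => ?_⟩
    interval_cases n
    · exact lieSpan_mono (by linarith) _ h0
    · exact lieSpan_mono (by linarith) _ h1
    · exact lieSpan_mono (by linarith) _ h2
  set d := Real.logb lam 2 with hd_def
  have hpos : 0 < 2 * N * lam ^ 4 := by positivity
  refine tendsto_log_div_log (c := (1 / (2 * N * lam ^ 4 * lam ^ 3)) ^ d)
    (C := 2 * (50 * (t + 1)) ^ d) (by positivity) (by positivity) ?_ ?_
  · have hev : ∀ᶠ n : ℕ in Filter.atTop, 2 * N * lam ^ 4 ≤ n :=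
      tendsto_natCast_atTop_atTop.eventually_ge_atTop _
    filter_upwards [hev] with n hn
    -- The largest `k` with `2 N λ^{3k+4} ≤ n`; passing to the next `k` costs the factor `λ^3` in
    -- the constant.
    obtain ⟨k, hk, hk'⟩ := exists_nat_pow_near (x := n / (2 * N * lam ^ 4)) (y := lam ^ 3)
      (by rwa [one_le_div hpos]) (one_lt_pow₀ h1 (by norm_num))
    rw [le_div_iff₀ hpos] at hk
    have hkn : 2 * N * lam ^ (3 * k + 4) ≤ n := by
      refine le_trans (le_of_eq ?_) hk
      rw [pow_add, pow_mul, mul_left_comm]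
    have hle := map_letterSpan_le_growthSpace hlam h₁ h₂ (by linarith) hpiv hkn
    -- Any large `M` will do: finite dimension is needed because `finrank` is 0 on
    -- infinite-dimensional spaces and would not be monotone.
    obtain ⟨M, hM⟩ := pow_unbounded_of_one_lt (50 * (n * t)) h1
    have := (pivotSpan_finrank K M).1
    have hfd : FiniteDimensional K (growthSpace (endGrading K) X n) :=
      Submodule.finiteDimensional_of_le (growthSpace_le_pivotSpan hlam h₁ h₂ ht hX hM)
    have hrank := Submodule.finrank_mono hle
    rw [← (Submodule.equivMapOfInjective _ (pivotTerm_injective _) _).finrank_eq,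
      (letterSpan_finrank K 2 (3 * k)).2] at hrank
    have hx : (n : ℝ) / (2 * N * lam ^ 4 * lam ^ 3) ≤ lam ^ (3 * k) := by
      rw [pow_succ (lam ^ 3), ← div_lt_iff₀ (by positivity), div_div, ← pow_mul] at hk'
      exact hk'.le
    calc (1 / (2 * N * lam ^ 4 * lam ^ 3)) ^ d * (n : ℝ) ^ d
        = (n / (2 * N * lam ^ 4 * lam ^ 3)) ^ d := by
          rw [← Real.mul_rpow (by positivity) (by positivity), one_div_mul_eq_div]
      _ ≤ (lam ^ (3 * k)) ^ d := by gcongr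
      _ = 2 ^ (3 * k) := pow_rpow_logb_two h1 _
      _ ≤ growth (endGrading K) X n := by exact_mod_cast hrank
  · filter_upwards [Filter.eventually_ge_atTop 1] with n hn
    have hn' : (1 : ℝ) ≤ n := by exact_mod_cast hn
    -- Using `t + 1` instead of `t` makes the argument at least 1 and covers `t = 0`.
    obtain ⟨M, hM, hM'⟩ := exists_nat_pow_near (x := 50 * (t + 1) * n) (y := lam)
      (by nlinarith) h1
    have hlt : 50 * (n * t) < lam ^ (M + 1) := lt_trans (by nlinarith) hM'
    obtain ⟨hfd, hrank⟩ := pivotSpan_finrank K (M + 1)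
    have hle := (Submodule.finrank_mono (growthSpace_le_pivotSpan hlam h₁ h₂ ht hX hlt)).trans hrank
    calc (growth (endGrading K) X n : ℝ) ≤ 2 ^ (M + 1) := by exact_mod_cast hle
      _ = 2 * (lam ^ M) ^ d := by rw [pow_rpow_logb_two h1, pow_succ, mul_comm]
      _ ≤ 2 * (50 * (t + 1) * n) ^ d := by gcongr
      _ = 2 * (50 * (t + 1)) ^ d * (n : ℝ) ^ d := by
        rw [Real.mul_rpow (by positivity) (by positivity), mul_assoc]

theorem gkDim_eq (hlam : lam ^ 3 = lam + 2) (h₁ : 1.5213 < lam) (h₂ : lam < 1.5214)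
    (hfin : X.Finite) (hhom : ∀ x ∈ X, ∃ α : ZMod 2, x ∈ endGrading K α)
    (hgen : lieSuper (endGrading K) X = Q K) :
    gkDim (endGrading K) X = (Real.logb lam 2 : ℝ) ∧
      lowerGkDim (endGrading K) X = (Real.logb lam 2 : ℝ) := by
  have h := (EReal.continuous_coe_iff.mpr continuous_id).continuousAt.tendsto.comp
    (tendsto_growth hlam h₁ h₂ hfin hhom hgen)
  exact ⟨h.limsup_eq, h.liminf_eq⟩

end Dimensions

end FractalSuper

end

theorem mainTheorem6 (K : Type*) [Field K] :
    ∃ lam : ℝ, (∀ t : ℝ, t ^ 3 - t - 2 = 0 ↔ t = lam) ∧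
      |lam - 1.5214| < 1 / 10 ^ 4 ∧
      |Real.logb lam 2 - 1.6518| < 1 / 10 ^ 4 ∧
      FractalSuper.gkDim (FractalSuper.endGrading K) (FractalSuper.pivotGens K)
        = (Real.logb lam 2 : ℝ) ∧
      FractalSuper.lowerGkDim (FractalSuper.endGrading K) (FractalSuper.pivotGens K)
        = (Real.logb lam 2 : ℝ) ∧
      ∀ X : Set (Module.End K (FractalSuper.Grassmann K)), X.Finite →
        (∀ x ∈ X, ∃ α : ZMod 2, x ∈ FractalSuper.endGrading K α) →
        FractalSuper.lieSuper (FractalSuper.endGrading K) X = FractalSuper.Q K →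
        FractalSuper.gkDim (FractalSuper.endGrading K) X = (Real.logb lam 2 : ℝ) ∧
        FractalSuper.lowerGkDim (FractalSuper.endGrading K) X = (Real.logb lam 2 : ℝ) := by
  obtain ⟨lam, hlam, h₁, h₂⟩ := FractalSuper.exists_root_cubic
  have h₁' : 1.5213 < lam := by linarith
  have h₂' : lam < 1.5214 := by linarith
  obtain ⟨hb₁, hb₂⟩ := FractalSuper.logb_two_bounds h₁ h₂
  have hgens := FractalSuper.gkDim_eq (K := K) (X := FractalSuper.pivotGens K) hlam h₁' h₂'
    (by simp [FractalSuper.pivotGens])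
    (by
      rintro x (rfl | rfl | rfl)
      exacts [⟨1, FractalSuper.pivot_odd K 0⟩, ⟨1, FractalSuper.pivot_odd K 1⟩,
        ⟨1, FractalSuper.pivot_odd K 2⟩])
    rfl
  refine ⟨lam, FractalSuper.cubic_eq_zero_iff hlam h₁', ?_, ?_, hgens.1, hgens.2,
    fun X hfin hhom hgen => FractalSuper.gkDim_eq hlam h₁' h₂' hfin hhom hgen⟩
  · rw [abs_lt]
    constructor <;> linarith
  · rw [abs_lt]
    constructor <;> linarith
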